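/- **Theorem 1.8.** Let $R$ be a commutative ring and $(A,L)$ a Lie–Rinehart algebra over $R$: $A$ is a commutative $R$-algebra, $L$ is a Lie algebra over $R$ and an $A$-module, and $L$ acts on $A$ by $R$-linear derivations, $(x,a)\mapsto x(a)$, so that $(ax)(b)=a\,x(b)$ and $[x,ay]=a[x,y]+x(a)y$. Suppose that $L$ is finitely generated and projective of constant rank $n$ as an $A$-module. *Definitions.* The Gerstenhaber bracket on $\Lambda_AL$ is the unique $R$-bilinear bracket of degree $-1$ with $[a,b]=0$ and $[x,a]=x(a)$ for $a,b\in A$, $x\in L$, which extends the Lie bracket of $L$ and satisfies, for homogeneous $u,v$ and all $w$, $$[u,v]=-(-1)^{(|u|-1)(|v|-1)}[v,u],\qquad [u,vw]=[u,v]w+(-1)^{(|u|-1)|v|}\,v[u,w].$$ A *generator* is an $R$-linear operator $D$ on $\Lambda_AL$ of degree $-1$ with $[u,v]=(-1)^{|u|}\bigl(D(uv)-(Du)v-(-1)^{|u|}u(Dv)\bigr)$ for homogeneous $u,v$; it is *exact* if $D^2=0$. An *$(A,L)$-connection* on an $A$-module $M$ is an operation $(x,m)\mapsto\nabla_xm$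 of $L$ on $M$ that is $A$-linear in $x$, $R$-linear in $m$, and satisfies $\nabla_x(am)=a\nabla_xm+x(a)m$; it is *flat* (a left $(A,L)$-module structure) if $\nabla_{[x,y]}=\nabla_x\nabla_y-\nabla_y\nabla_x$. For $0\le p\le n$ and $\alpha\in\Lambda^p_AL$ let $$\phi_\alpha\in\mathrm{Alt}^{n-p}_A(L,\Lambda^n_AL),\qquad \phi_\alpha(\xi_1,\dots,\xi_{n-p})=\alpha\wedge\xi_1\wedge\dots\wedge\xi_{n-p}.$$ For a connection $\nabla$ on $\Lambda^n_AL$ and $f\in\mathrm{Alt}^{n-p}_A(L,\Lambda^n_AL)$ (an element of degree $p$), let $$(d^\nabla f)(\xi_0,\dots,\xi_{n-p})=(-1)^{p+1}\Bigl(\sum_{i}(-1)^i\nabla_{\xi_i}\bigl(f(\dots\widehat{\xi_i}\dots)\bigr)+\sum_{i<j}(-1)^{i+j}f([\xi_i,\xi_j],\dots\widehat{\xi_i}\dots\widehat{\xi_j}\dots)\Bigr).$$ Let $\lambda_x$ ($x\in L$) be the Lie derivative on $\Lambda^n_AL$, that is, the bracket with $x$, so that $\lambda_x(\xi_1\wedge\dots\wedge\xi_n)=\sum_j\xi_1\wedge\dots\wedge[x,\xi_j]\wedge\dots\wedge\xi_n$.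 *Statement.* For $0\le p\le n$ the map $\phi\colon\Lambda^p_AL\to\mathrm{Alt}^{n-p}_A(L,\Lambda^n_AL)$ is an isomorphism of $A$-modules. The relation $$\phi_{D(\alpha)}=-d^\nabla(\phi_\alpha)\qquad\text{for all homogeneous }\alpha\in\Lambda_AL$$ (where $D(\alpha)=0$, and hence the left-hand side is $0$, for $\alpha$ of degree $0$) is the graph of a bijection between generators $D$ of the Gerstenhaber bracket on $\Lambda_AL$ and $(A,L)$-connections $\nabla$ on $\Lambda^n_AL$. Under this bijection a generator is exact if and only if the corresponding connection is flat. Moreover, $D$ and $\nabla$ correspond to each other under this bijection if and only if $$(Dx)\,\omega=\lambda_x(\omega)-\nabla_x(\omega)\qquad\text{for all }x\in L,\ \omega\in\Lambda^n_AL.$$ -/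

import Mathlib

noncomputable section

namespace LieRinehart

open ExteriorAlgebra

section Construction

/-! Auxiliary facts on the exterior algebra, used to construct the Gerstenhaber bracket. -/

variable {A L : Type*} [CommRing A] [AddCommGroup L] [Module A L]

theorem extPow_induction {P : ℕ → ExteriorAlgebra A L → Prop}
    (alg : ∀ a : A, P 0 (algebraMap A (ExteriorAlgebra A L) a))
    (add : ∀ p u v, P p u → P p v → P p (u + v))
    (mul : ∀ p (y : L) u, u ∈ ⋀[A]^p L → P p u → P (p + 1) (ι A y * u))
    {p : ℕ} {u : ExteriorAlgebra A L} (hu : u ∈ ⋀[A]^p L) : P p u := by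
  induction hu using Submodule.pow_induction_on_left' with
  | algebraMap a => exact alg a
  | add x y i hx hy h1 h2 => exact add _ _ _ h1 h2
  | mem_mul m hm i x hx h => obtain ⟨y, rfl⟩ := hm; exact mul _ _ _ hx h

theorem ι_mul_eq_involute_mul (y : L) (u : ExteriorAlgebra A L) :
    ι A y * u = CliffordAlgebra.involute u * ι A y := by
  induction u using CliffordAlgebra.left_induction with
  | algebraMap r => rw [AlgHom.commutes]; exact (Algebra.commutes r _).symm
  | add u v hu hv => rw [mul_add, hu, hv, map_add, add_mul]
  | ι_mul u z hu =>
    have h := ExteriorAlgebra.ι_add_mul_swap (R := A) y z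
    rw [map_mul, CliffordAlgebra.involute_ι, mul_assoc, ← hu, ← mul_assoc, ← mul_assoc,
      eq_neg_of_add_eq_zero_left h, neg_mul, neg_mul, neg_mul]

theorem involute_of_mem {p : ℕ} {u : ExteriorAlgebra A L} (hu : u ∈ ⋀[A]^p L) :
    CliffordAlgebra.involute u = (-1 : ℤ) ^ p • u := by
  refine extPow_induction (P := fun p u => CliffordAlgebra.involute u = (-1 : ℤ) ^ p • u)
    ?_ ?_ ?_ hu
  · intro a; simp
  · intro p u v hu hv; rw [map_add, hu, hv, smul_add]
  · intro p y u _ hu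
    rw [map_mul, CliffordAlgebra.involute_ι, hu, pow_succ, mul_neg_one, neg_smul, neg_mul,
      mul_smul_comm]

theorem mem_zero_iff {u : ExteriorAlgebra A L} :
    u ∈ ⋀[A]^0 L ↔ ∃ a : A, algebraMap A (ExteriorAlgebra A L) a = u := by
  have h : (⋀[A]^0 L : Submodule A (ExteriorAlgebra A L)) = 1 := pow_zero _
  rw [h, Submodule.mem_one]

theorem ι_mem (y : L) : ι A y ∈ ⋀[A]^1 L := by
  simp

theorem ι_mul_mem {p : ℕ} {u : ExteriorAlgebra A L} (y : L) (hu : u ∈ ⋀[A]^p L) :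
    ι A y * u ∈ ⋀[A]^(p + 1) L := by
  have := SetLike.mul_mem_graded (A := fun i : ℕ => ⋀[A]^i L) (ι_mem (A := A) y) hu
  rwa [add_comm] at this

theorem graded_comm {p q : ℕ} {u v : ExteriorAlgebra A L} (hu : u ∈ ⋀[A]^p L)
    (hv : v ∈ ⋀[A]^q L) : u * v = (-1 : ℤ) ^ (p * q) • (v * u) := by
  refine extPow_induction (P := fun p u => u * v = (-1 : ℤ) ^ (p * q) • (v * u)) ?_ ?_ ?_ hu
  · intro a; simp [Algebra.commutes]
  · intro p u w hu hw; rw [add_mul, hu, hw, mul_add, smul_add]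
  · intro p y u _ hu
    rw [mul_assoc, hu, mul_smul_comm, ← mul_assoc, ι_mul_eq_involute_mul, involute_of_mem hv,
      smul_mul_assoc, smul_mul_assoc, smul_smul, ← pow_add, mul_assoc]
    congr 2; ring

/-- Auxiliary type used only to construct the bracket: a copy of `Λ × P` that will carry the
`A`-module structure `a • (u, m) = (a u, a m + c a u)`. -/
def Twist {P : Type*} (_c : A → ExteriorAlgebra A L → P) : Type _ := ExteriorAlgebra A L × P

theorem exists_twisted {P : Type*} [AddCommGroup P] [Module (ExteriorAlgebra A L) P]
    (c : A → ExteriorAlgebra A L → P) (g : L → ExteriorAlgebra A L → P)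
    (c_add : ∀ a u v, c a (u + v) = c a u + c a v)
    (c_add' : ∀ a b u, c (a + b) u = c a u + c b u)
    (c_mul : ∀ a b u, c (a * b) u = algebraMap A (ExteriorAlgebra A L) a • c b u + c a (b • u))
    (g_add : ∀ y u v, g y (u + v) = g y u + g y v)
    (g_add' : ∀ y z u, g (y + z) u = g y u + g z u)
    (g_smul : ∀ a y u, g (a • y) u =
      algebraMap A (ExteriorAlgebra A L) a • g y u + c a (ι A y * u))
    (g_smul' : ∀ a y u, ι A y • c a u + g y (a • u) =
      algebraMap A (ExteriorAlgebra A L) a • g y u + c a (ι A y * u))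
    (g_sq : ∀ y u, ι A y • g y u + g y (ι A y * u) = 0) :
    ∃ T : ExteriorAlgebra A L →+ P, (∀ a, T (algebraMap A (ExteriorAlgebra A L) a) = c a 1) ∧
      (∀ y u, T (ι A y * u) = ι A y • T u + g y u) ∧
      ∀ a u, T (a • u) = algebraMap A (ExteriorAlgebra A L) a • T u + c a u := by
  let i1 : AddCommGroup (Twist c) := inferInstanceAs (AddCommGroup (ExteriorAlgebra A L × P))
  have c_zero : ∀ a, c a 0 = 0 := fun a => by simpa using c_add a 0 0
  have c_zero' : ∀ u, c 0 u = 0 := fun u => by simpa using c_add' 0 0 u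
  have c_one : ∀ u, c 1 u = 0 := fun u => by simpa using c_mul 1 1 u
  have g_zero : ∀ y, g y 0 = 0 := fun a => by simpa using g_add a 0 0
  let i2 : Module A (Twist c) :=
    { smul := fun a x => ((a • x.1, algebraMap A (ExteriorAlgebra A L) a • x.2 + c a x.1) :
        ExteriorAlgebra A L × P)
      one_smul := fun x => Prod.ext (one_smul _ _) (by
        change algebraMap A (ExteriorAlgebra A L) 1 • x.2 + c 1 x.1 = x.2
        rw [c_one, map_one, one_smul, add_zero])
      mul_smul := fun a b x => Prod.ext (mul_smul _ _ _) (by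
        change algebraMap A (ExteriorAlgebra A L) (a * b) • x.2 + c (a * b) x.1 =
          algebraMap A (ExteriorAlgebra A L) a •
            (algebraMap A (ExteriorAlgebra A L) b • x.2 + c b x.1) + c a (b • x.1)
        rw [c_mul, map_mul, mul_smul, smul_add, add_assoc])
      smul_zero := fun a => Prod.ext (smul_zero _) (by
        change algebraMap A (ExteriorAlgebra A L) a • (0 : P) + c a 0 = 0
        rw [c_zero, smul_zero, add_zero])
      zero_smul := fun x => Prod.ext (zero_smul _ _) (by
        change algebraMap A (ExteriorAlgebra A L) 0 • x.2 + c 0 x.1 = 0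
        rw [c_zero', map_zero, zero_smul, add_zero])
      smul_add := fun a x y => Prod.ext (smul_add _ _ _) (by
        change algebraMap A (ExteriorAlgebra A L) a • (x.2 + y.2) + c a (x.1 + y.1) =
          (algebraMap A (ExteriorAlgebra A L) a • x.2 + c a x.1) +
          (algebraMap A (ExteriorAlgebra A L) a • y.2 + c a y.1)
        rw [c_add, smul_add]; abel)
      add_smul := fun a b x => Prod.ext (add_smul _ _ _) (by
        change algebraMap A (ExteriorAlgebra A L) (a + b) • x.2 + c (a + b) x.1 =
          (algebraMap A (ExteriorAlgebra A L) a • x.2 + c a x.1) +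
          (algebraMap A (ExteriorAlgebra A L) b • x.2 + c b x.1)
        rw [c_add', map_add, add_smul]; abel) }
  have comm : ∀ (a : A) (y : L) (m : P),
      ι A y • algebraMap A (ExteriorAlgebra A L) a • m =
        algebraMap A (ExteriorAlgebra A L) a • ι A y • m := fun a y m => by
    rw [← mul_smul, ← mul_smul, Algebra.commutes]
  let f : L →ₗ[A] Twist c →ₗ[A] Twist c :=
    LinearMap.mk₂ A
      (fun y x => ((ι A y * x.1, ι A y • x.2 + g y x.1) : ExteriorAlgebra A L × P))
      (fun y z x => Prod.ext (by
          change ι A (y + z) * x.1 = ι A y * x.1 + ι A z * x.1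
          rw [map_add, add_mul]) (by
          change ι A (y + z) • x.2 + g (y + z) x.1 =
            (ι A y • x.2 + g y x.1) + (ι A z • x.2 + g z x.1)
          rw [g_add', map_add, add_smul]; abel))
      (fun a y x => Prod.ext (by
          change ι A (a • y) * x.1 = a • (ι A y * x.1)
          rw [map_smul, smul_mul_assoc]) (by
          change ι A (a • y) • x.2 + g (a • y) x.1 =
            algebraMap A (ExteriorAlgebra A L) a • (ι A y • x.2 + g y x.1) + c a (ι A y * x.1)
          rw [g_smul, map_smul, Algebra.smul_def, mul_smul, smul_add, add_assoc]))
      (fun y x z => Prod.ext (by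
          change ι A y * (x.1 + z.1) = ι A y * x.1 + ι A y * z.1
          rw [mul_add]) (by
          change ι A y • (x.2 + z.2) + g y (x.1 + z.1) =
            (ι A y • x.2 + g y x.1) + (ι A y • z.2 + g y z.1)
          rw [g_add, smul_add]; abel))
      (fun a y x => Prod.ext (by
          change ι A y * (a • x.1) = a • (ι A y * x.1)
          rw [mul_smul_comm]) (by
          change ι A y • (algebraMap A (ExteriorAlgebra A L) a • x.2 + c a x.1) + g y (a • x.1) =
            algebraMap A (ExteriorAlgebra A L) a • (ι A y • x.2 + g y x.1) + c a (ι A y * x.1)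
          rw [smul_add, add_assoc, g_smul', smul_add, comm, add_assoc]))
  have hf : ∀ (y : L) (x : Twist c), f y (f y x) = (0 : QuadraticForm A L) y • x := by
    intro y x
    rw [zero_apply, zero_smul]
    refine Prod.ext ?_ ?_
    · change ι A y * (ι A y * x.1) = 0
      rw [← mul_assoc, ExteriorAlgebra.ι_sq_zero, zero_mul]
    · change ι A y • (ι A y • x.2 + g y x.1) + g y (ι A y * x.1) = 0
      rw [smul_add, add_assoc, g_sq, ← mul_smul, ExteriorAlgebra.ι_sq_zero, zero_smul, add_zero]
  let x₀ : Twist c := ((1, 0) : ExteriorAlgebra A L × P)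
  let F := CliffordAlgebra.foldr (0 : QuadraticForm A L) f hf x₀
  have hF_alg : ∀ a, F (algebraMap A (ExteriorAlgebra A L) a) = a • x₀ := fun a =>
    CliffordAlgebra.foldr_algebraMap _ f hf x₀ a
  have hF_mul : ∀ y u, F (ι A y * u) = f y (F u) := fun y u => by
    change CliffordAlgebra.foldr _ f hf x₀ (ι A y * u) = _
    rw [CliffordAlgebra.foldr_mul]
    exact CliffordAlgebra.foldr_ι _ f hf _ y
  have hF_fst : ∀ u, (F u).1 = u := by
    intro u
    induction u using CliffordAlgebra.left_induction with
    | algebraMap r =>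
      rw [hF_alg]
      change r • (1 : ExteriorAlgebra A L) = _
      rw [Algebra.algebraMap_eq_smul_one]
    | add u v hu hv =>
      rw [map_add]
      change (F u).1 + (F v).1 = _
      rw [hu, hv]
    | ι_mul u z hu =>
      rw [hF_mul]
      change ι A z * (F u).1 = _
      rw [hu]
  refine ⟨⟨⟨fun u => (F u).2, ?_⟩, ?_⟩, ?_, ?_, ?_⟩
  · rw [map_zero]; rfl
  · intro u v; simp only [map_add]; rfl
  · intro a
    change (F _).2 = _
    rw [hF_alg]
    change algebraMap A (ExteriorAlgebra A L) a • (0 : P) + c a 1 = _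
    rw [smul_zero, zero_add]
  · intro y u
    change (F _).2 = ι A y • (F u).2 + _
    rw [hF_mul]
    change ι A y • (F u).2 + g y (F u).1 = _
    rw [hF_fst]
  · intro a u
    change (F _).2 = algebraMap A (ExteriorAlgebra A L) a • (F u).2 + _
    rw [map_smul]
    change algebraMap A (ExteriorAlgebra A L) a • (F u).2 + c a (F u).1 = _
    rw [hF_fst]

theorem contractLeft_mem (d : Module.Dual A L) {p : ℕ} {u : ExteriorAlgebra A L}
    (hu : u ∈ ⋀[A]^p L) : ∀ q, p = q + 1 → CliffordAlgebra.contractLeft d u ∈ ⋀[A]^q L := by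
  refine extPow_induction (P := fun p u => ∀ q, p = q + 1 →
    CliffordAlgebra.contractLeft d u ∈ ⋀[A]^q L) ?_ ?_ ?_ hu
  · intro a q hq; omega
  · intro p u v hu hv q hq
    rw [map_add]
    exact add_mem (hu q hq) (hv q hq)
  · intro p y u hu h q hq
    obtain rfl : p = q := by omega
    rw [CliffordAlgebra.contractLeft_ι_mul]
    refine sub_mem (Submodule.smul_mem _ _ hu) ?_
    rcases p with _ | p
    · have h0 : CliffordAlgebra.contractLeft d u = 0 := by
        obtain ⟨r, rfl⟩ := mem_zero_iff.1 hu
        exact CliffordAlgebra.contractLeft_algebraMap _ _ _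
      rw [h0, mul_zero]
      exact zero_mem _
    · exact ι_mul_mem y (h p rfl)

theorem contractLeft_mul (d : Module.Dual A L) {p : ℕ} {u : ExteriorAlgebra A L}
    (hu : u ∈ ⋀[A]^p L) (v : ExteriorAlgebra A L) :
    CliffordAlgebra.contractLeft d (u * v) = CliffordAlgebra.contractLeft d u * v +
      (-1 : ℤ) ^ p • (u * CliffordAlgebra.contractLeft d v) := by
  refine extPow_induction (P := fun p u => CliffordAlgebra.contractLeft d (u * v) =
    CliffordAlgebra.contractLeft d u * v +
      (-1 : ℤ) ^ p • (u * CliffordAlgebra.contractLeft d v)) ?_ ?_ ?_ hu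
  · intro a
    rw [CliffordAlgebra.contractLeft_algebraMap, ← Algebra.smul_def, map_smul, zero_mul, zero_add,
      pow_zero, one_smul, Algebra.smul_def]
  · intro p u w hu hw
    simp only [add_mul, map_add, hu, hw, smul_add]
    abel
  · intro p y u _ hu
    rw [mul_assoc, CliffordAlgebra.contractLeft_ι_mul, CliffordAlgebra.contractLeft_ι_mul, hu,
      pow_succ, mul_neg_one, neg_smul, mul_add, mul_smul_comm, sub_mul, smul_mul_assoc,
      mul_assoc, mul_assoc]
    abel

end Construction

variable (R A L : Type*) [CommRing R] [CommRing A] [Algebra R A] [LieRing L] [LieAlgebra R L]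
  [Module A L] [LieRingModule L A] [LieRinehartRing A L] [LieRinehartAlgebra R A L]

/-- `B` is a Gerstenhaber bracket on the exterior `A`-algebra of `L` that extends the Lie bracket of
`L` and the action of `L` on `A`: it is `R`-bilinear of degree `-1`, graded antisymmetric
(`[u, v] = -(-1)^((|u| - 1)(|v| - 1)) [v, u]`) and `[u, -]` is a graded derivation of degree
`|u| - 1`. (Exponents are written with `+ 1` in place of `- 1`, which does not change the parity.)
By `existsUnique_gerstenhaberBracket` there is exactly one such `B`; the graded Jacobi identity is
a consequence. -/
structure IsGerstenhaberBracket
    (B : ExteriorAlgebra A L →ₗ[R] ExteriorAlgebra A L →ₗ[R] ExteriorAlgebra A L) : Prop where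
  lie_algebraMap_algebraMap (a b : A) :
    B (algebraMap A _ a) (algebraMap A _ b) = 0
  lie_ι_algebraMap (x : L) (a : A) :
    B (ι A x) (algebraMap A _ a) = algebraMap A _ ⁅x, a⁆
  lie_ι_ι (x y : L) : B (ι A x) (ι A y) = ι A ⁅x, y⁆
  lie_mem (p q m : ℕ) (h : p + q = m + 1) (u v : ExteriorAlgebra A L) (hu : u ∈ ⋀[A]^p L)
    (hv : v ∈ ⋀[A]^q L) : B u v ∈ ⋀[A]^m L
  lie_skew (p q : ℕ) (u v : ExteriorAlgebra A L) (hu : u ∈ ⋀[A]^p L) (hv : v ∈ ⋀[A]^q L) :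
    B u v = -((-1 : ℤ) ^ ((p + 1) * (q + 1)) • B v u)
  lie_mul (p q : ℕ) (u v w : ExteriorAlgebra A L) (hu : u ∈ ⋀[A]^p L) (hv : v ∈ ⋀[A]^q L) :
    B u (v * w) = B u v * w + (-1 : ℤ) ^ ((p + 1) * q) • (v * B u w)

variable {R A L}

theorem IsGerstenhaberBracket.unique
    {B B' : ExteriorAlgebra A L →ₗ[R] ExteriorAlgebra A L →ₗ[R] ExteriorAlgebra A L}
    (h : IsGerstenhaberBracket R A L B) (h' : IsGerstenhaberBracket R A L B') : B = B' := by
  have ma : ∀ a : A, algebraMap A (ExteriorAlgebra A L) a ∈ ⋀[A]^0 L := fun a => mem_zero_iff.2 ⟨a, rfl⟩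
  have step : ∀ (p : ℕ) (u : ExteriorAlgebra A L) (_ : u ∈ ⋀[A]^p L)
      (_ : ∀ a : A, B u (algebraMap A _ a) = B' u (algebraMap A _ a))
      (_ : ∀ y : L, B u (ι A y) = B' u (ι A y)), B u = B' u := by
    intro p u hu ha hy
    ext v
    induction v using CliffordAlgebra.left_induction with
    | algebraMap a => exact ha a
    | add v w hv hw => rw [map_add, map_add, hv, hw]
    | ι_mul v y hv =>
      have e := h.lie_mul p 1 u (ι A y) v hu (ι_mem y)
      have e' := h'.lie_mul p 1 u (ι A y) v hu (ι_mem y)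
      rw [e, e', hv, hy]
  have hx : ∀ x : L, B (ι A x) = B' (ι A x) := fun x => step 1 _ (ι_mem x)
    (fun a => by rw [h.lie_ι_algebraMap, h'.lie_ι_algebraMap])
    (fun y => by rw [h.lie_ι_ι, h'.lie_ι_ι])
  have hA : ∀ a : A, B (algebraMap A _ a) = B' (algebraMap A _ a) := fun a => step 0 _ (ma a)
    (fun a => by rw [h.lie_algebraMap_algebraMap, h'.lie_algebraMap_algebraMap])
    (fun y => by
      rw [h.lie_skew 0 1 _ _ (ma a) (ι_mem y), h'.lie_skew 0 1 _ _ (ma a) (ι_mem y), hx])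
  have hom : ∀ (p : ℕ) (u : ExteriorAlgebra A L) (_ : u ∈ ⋀[A]^p L), B u = B' u :=
    fun p u hu => step p u hu
      (fun a => by rw [h.lie_skew p 0 _ _ hu (ma a), h'.lie_skew p 0 _ _ hu (ma a), hA])
      (fun y => by rw [h.lie_skew p 1 _ _ hu (ι_mem y), h'.lie_skew p 1 _ _ hu (ι_mem y), hx])
  ext u : 1
  induction u using DirectSum.Decomposition.inductionOn fun i => ⋀[A]^i L with
  | zero => rw [map_zero, map_zero]
  | add u v hu hv => rw [map_add, map_add, hu, hv]
  | homogeneous u => exact hom _ _ u.2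

/-- The differential `da : L → A`, `x ↦ x(a)`, of an element `a` of `A`. -/
def dual (a : A) : Module.Dual A L where
  toFun x := ⁅x, a⁆
  map_add' x y := add_lie x y a
  map_smul' b x := by simp

theorem lie_algebraMap_eq_zero (x : L) (r : R) : ⁅x, algebraMap R A r⁆ = 0 := by
  rw [← LieRinehartAlgebra.anchor_apply (R := R)]
  exact Derivation.map_algebraMap _ r

theorem exists_lieDerivative : ∃ lam : L → ExteriorAlgebra A L →ₗ[R] ExteriorAlgebra A L,
    (∀ x a, lam x (algebraMap A _ a) = algebraMap A _ ⁅x, a⁆) ∧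
    (∀ x y u, lam x (ι A y * u) = ι A y * lam x u + ι A ⁅x, y⁆ * u) := by
  have key : ∀ x : L, ∃ T : ExteriorAlgebra A L →+ ExteriorAlgebra A L,
      (∀ a, T (algebraMap A _ a) = algebraMap A _ ⁅x, a⁆) ∧
      (∀ y u, T (ι A y * u) = ι A y * T u + ι A ⁅x, y⁆ * u) ∧
      (∀ (a : A) u, T (a • u) = a • T u + ⁅x, a⁆ • u) := by
    intro x
    have := exists_twisted (A := A) (L := L) (P := ExteriorAlgebra A L)
      (fun a u => algebraMap A _ ⁅x, a⁆ * u) (fun y u => ι A ⁅x, y⁆ * u)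
      (fun a u v => mul_add _ _ _) (fun a b u => by simp [add_mul])
      (fun a b u => by
        simp only [LieRinehartRing.leibniz_mul_right, map_add, smul_eq_mul, map_mul, add_mul,
          Algebra.smul_def, mul_assoc])
      (fun a u v => mul_add _ _ _) (fun a b u => by simp [add_mul])
      (fun a y u => by
        simp only [LieRinehartRing.leibniz_smul_right, map_add, add_mul, smul_eq_mul, map_smul,
          Algebra.smul_def, mul_assoc])
      (fun a y u => by
        rw [smul_eq_mul, smul_eq_mul, ← mul_assoc, ← Algebra.commutes, mul_smul_comm,
          Algebra.smul_def, mul_assoc, add_comm])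
      (fun y u => by
        rw [smul_eq_mul, ← mul_assoc, ← mul_assoc, ← add_mul, ExteriorAlgebra.ι_add_mul_swap,
          zero_mul])
    obtain ⟨T, h1, h2, h3⟩ := this
    exact ⟨T, fun a => by rw [h1, mul_one], h2, fun a u => by
      rw [h3, Algebra.smul_def, Algebra.smul_def, smul_eq_mul]⟩
  choose T h1 h2 hsm using key
  refine ⟨fun x => { T x with map_smul' := fun r u => ?_ }, h1, h2⟩
  change T x (r • u) = r • T x u
  have h0 := lie_algebraMap_eq_zero (A := A) x r
  rw [← algebraMap_smul A r u, hsm, h0, zero_smul, add_zero, algebraMap_smul]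

theorem exists_bracket : ∃ (lam : L → ExteriorAlgebra A L →ₗ[R] ExteriorAlgebra A L)
    (B : ExteriorAlgebra A L →ₗ[R] ExteriorAlgebra A L →ₗ[R] ExteriorAlgebra A L),
    (∀ x a, lam x (algebraMap A _ a) = algebraMap A _ ⁅x, a⁆) ∧
    (∀ x y u, lam x (ι A y * u) = ι A y * lam x u + ι A ⁅x, y⁆ * u) ∧
    (∀ (a : A) v, B (algebraMap A _ a) v = -CliffordAlgebra.contractLeft (dual a) v) ∧
    (∀ x u v, B (ι A x * u) v = ι A x * B u v + CliffordAlgebra.involute u * lam x v) := by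
  obtain ⟨lam, h1, h2⟩ := exists_lieDerivative (R := R) (A := A) (L := L)
  have lam_add : ∀ x y v, lam (x + y) v = lam x v + lam y v := by
    intro x y v
    induction v using CliffordAlgebra.left_induction with
    | algebraMap r => rw [h1, h1, h1, add_lie, map_add]
    | add u v hu hv => rw [map_add, map_add, map_add, hu, hv]; abel
    | ι_mul u z hu => rw [h2, h2, h2, hu, add_lie, map_add, mul_add, add_mul]; abel
  have lam_smul : ∀ (a : A) x v, lam (a • x) v =
      a • lam x v - ι A x * CliffordAlgebra.contractLeft (dual a) v := by
    intro a x v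
    induction v using CliffordAlgebra.left_induction with
    | algebraMap r =>
      rw [h1, h1, LieRinehartRing.lie_smul_eq_mul, CliffordAlgebra.contractLeft_algebraMap,
        mul_zero, sub_zero, map_mul, Algebra.smul_def]
    | add u v hu hv => rw [map_add, map_add, map_add, hu, hv, mul_add, smul_add]; abel
    | ι_mul u z hu =>
      have e : ⁅a • x, z⁆ = a • ⁅x, z⁆ - dual a z • x := by
        rw [← lie_skew, LieRinehartRing.leibniz_smul_right, ← lie_skew x z]
        change -(a • ⁅z, x⁆ + ⁅z, a⁆ • x) = a • -⁅z, x⁆ - ⁅z, a⁆ • x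
        rw [smul_neg]; abel
      have sw : ι A z * ι A x = -(ι A x * ι A z) :=
        eq_neg_of_add_eq_zero_left (ExteriorAlgebra.ι_add_mul_swap z x)
      rw [h2, h2, hu, e, CliffordAlgebra.contractLeft_ι_mul, map_sub, map_smul, map_smul,
        mul_sub, mul_sub, sub_mul, ← mul_assoc, ← mul_assoc, sw, smul_add, mul_smul_comm,
        mul_smul_comm, smul_mul_assoc, smul_mul_assoc, neg_mul]
      abel
  let c : A → ExteriorAlgebra A L → (ExteriorAlgebra A L →ₗ[R] ExteriorAlgebra A L) :=
    fun a u => -(LinearMap.mulLeft R u ∘ₗ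
      (CliffordAlgebra.contractLeft (Q := (0 : QuadraticForm A L)) (dual a)).restrictScalars R)
  let g : L → ExteriorAlgebra A L → (ExteriorAlgebra A L →ₗ[R] ExteriorAlgebra A L) :=
    fun y u => LinearMap.mulLeft R (CliffordAlgebra.involute u) ∘ₗ lam y
  have hc : ∀ a u v, c a u v = -(u * CliffordAlgebra.contractLeft (dual a) v) :=
    fun a u v => rfl
  have hg : ∀ y u v, g y u v = CliffordAlgebra.involute u * lam y v := fun y u v => rfl
  have dual_add : ∀ a b : A, dual (L := L) (a + b) = dual a + dual b := fun a b => by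
    ext x; exact lie_add x a b
  have dual_mul : ∀ a b : A, dual (L := L) (a * b) = a • dual b + b • dual a := fun a b => by
    ext x
    change ⁅x, a * b⁆ = a * ⁅x, b⁆ + b * ⁅x, a⁆
    rw [LieRinehartRing.leibniz_mul_right, smul_eq_mul, mul_comm b]
  have inv_smul : ∀ (a : A) (u : ExteriorAlgebra A L),
      CliffordAlgebra.involute (a • u) = a • CliffordAlgebra.involute u := fun a u => map_smul _ _ _
  have g_smul' : ∀ (a : A) y u, ι A y • c a u + g y (a • u) =
      algebraMap A (ExteriorAlgebra A L) a • g y u + c a (ι A y * u) := by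
    intro a y u
    ext v
    simp only [LinearMap.add_apply, LinearMap.smul_apply, hc, hg, smul_eq_mul, inv_smul,
      ← Algebra.smul_def, smul_mul_assoc, mul_assoc, mul_neg]
    abel
  obtain ⟨T, t1, t2, t3⟩ := exists_twisted (A := A) (L := L) c g
    (fun a u v => by ext w; simp only [hc, LinearMap.add_apply, add_mul, neg_add])
    (fun a b u => by
      ext w
      simp only [hc, LinearMap.add_apply, dual_add, map_add, mul_add, neg_add])
    (fun a b u => by
      ext w
      simp only [hc, LinearMap.add_apply, LinearMap.smul_apply, dual_mul, map_add, map_smul,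
        mul_add, neg_add, smul_eq_mul, mul_neg, ← Algebra.smul_def, mul_smul_comm,
        smul_mul_assoc])
    (fun a u v => by ext w; simp only [hg, LinearMap.add_apply, map_add, add_mul])
    (fun a u v => by ext w; simp only [hg, LinearMap.add_apply, lam_add, mul_add])
    (fun a y u => by
      ext w
      simp only [hg, hc, LinearMap.add_apply, LinearMap.smul_apply, lam_smul, mul_sub,
        ι_mul_eq_involute_mul y u, smul_eq_mul, ← Algebra.smul_def, mul_smul_comm, mul_assoc]
      abel)
    g_smul'
    (fun y u => by
      ext w
      simp only [hg, LinearMap.add_apply, LinearMap.smul_apply, map_mul,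
        CliffordAlgebra.involute_ι, smul_eq_mul, mul_assoc, neg_mul]
      exact add_neg_cancel _)
  refine ⟨lam, { T with map_smul' := fun r u => ?_ }, h1, h2, ?_, ?_⟩
  · change T (r • u) = r • T u
    have h0 : dual (L := L) (algebraMap R A r) = 0 := by
      ext x; exact lie_algebraMap_eq_zero x r
    rw [← algebraMap_smul A r u, t3]
    ext v
    simp only [LinearMap.add_apply, LinearMap.smul_apply, hc, h0, map_zero,
      LinearMap.zero_apply, mul_zero, neg_zero, add_zero, algebraMap_smul]
  · intro a v
    change T _ v = _
    rw [t1, hc, one_mul]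
  · intro x u v
    change T _ v = _ * T u v + _
    rw [t2]
    rfl

theorem exists_gerstenhaberBracket : ∃ B, IsGerstenhaberBracket R A L B := by
  obtain ⟨lam, B, l1, l2, b1, b2⟩ := exists_bracket (R := R) (A := A) (L := L)
  have algmem : ∀ a : A, algebraMap A (ExteriorAlgebra A L) a ∈ ⋀[A]^0 L :=
    fun a => mem_zero_iff.2 ⟨a, rfl⟩
  have l3 : ∀ x y, lam x (ι A y) = ι A ⁅x, y⁆ := fun x y => by
    have := l2 x y (algebraMap A _ 1)
    have h0 := lie_algebraMap_eq_zero (A := A) x (1 : R)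
    rw [map_one] at h0
    rwa [l1, h0, map_zero, mul_zero, zero_add, map_one, mul_one, mul_one] at this
  have lmem : ∀ x q v, v ∈ ⋀[A]^q L → lam x v ∈ ⋀[A]^q L := by
    intro x q v hv
    refine extPow_induction (P := fun q v => lam x v ∈ ⋀[A]^q L) ?_ ?_ ?_ hv
    · intro a; rw [l1]; exact algmem _
    · intro p u v hu hv; rw [map_add]; exact add_mem hu hv
    · intro p y u hu h; rw [l2]; exact add_mem (ι_mul_mem _ h) (ι_mul_mem _ hu)
  have lmul : ∀ x u v, lam x (u * v) = lam x u * v + u * lam x v := by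
    intro x u v
    induction u using CliffordAlgebra.left_induction with
    | algebraMap a =>
      rw [l1]
      induction v using CliffordAlgebra.left_induction with
      | algebraMap b =>
        rw [← map_mul, l1, l1, LieRinehartRing.leibniz_mul_right, map_add, smul_eq_mul, map_mul,
          map_mul, add_comm]
      | add u v hu hv => rw [mul_add, map_add, hu, hv, map_add, mul_add, mul_add]; abel
      | ι_mul u y hu =>
        have e : algebraMap A (ExteriorAlgebra A L) a * (ι A y * u) =
            ι A y * (algebraMap A (ExteriorAlgebra A L) a * u) := by
          rw [← mul_assoc, Algebra.commutes, mul_assoc]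
        have e' : ∀ z : L, algebraMap A (ExteriorAlgebra A L) a * (ι A z * u) =
            ι A z * (algebraMap A (ExteriorAlgebra A L) a * u) := fun z => by
          rw [← mul_assoc, Algebra.commutes, mul_assoc]
        rw [e, l2, l2, hu, mul_add, mul_add, e', ← mul_assoc, ← mul_assoc, ← mul_assoc,
          ← mul_assoc, ← mul_assoc, ← Algebra.commutes, ← Algebra.commutes a]
        abel
    | add u w hu hw => rw [add_mul, map_add, hu, hw, map_add, add_mul, add_mul]; abel
    | ι_mul u y hu =>
      rw [mul_assoc, l2, l2, hu]
      simp only [mul_add, add_mul, mul_assoc]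
      abel
  have b3 : ∀ x v, B (ι A x) v = lam x v := fun x v => by
    have := b2 x 1 v
    have h0 : B 1 v = 0 := by
      rw [← map_one (algebraMap A (ExteriorAlgebra A L)), b1]
      have : dual (L := L) (1 : A) = 0 := by
        ext y
        have := lie_algebraMap_eq_zero (A := A) y (1 : R)
        rwa [map_one] at this
      rw [this, map_zero, LinearMap.zero_apply, neg_zero]
    rwa [mul_one, h0, mul_zero, zero_add, map_one, one_mul] at this
  have lie_mul : ∀ (p q : ℕ) (u v w : ExteriorAlgebra A L) (_ : u ∈ ⋀[A]^p L)
      (_ : v ∈ ⋀[A]^q L),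
      B u (v * w) = B u v * w + (-1 : ℤ) ^ ((p + 1) * q) • (v * B u w) := by
    intro p q u v w hu hv
    refine extPow_induction (P := fun p u =>
      B u (v * w) = B u v * w + (-1 : ℤ) ^ ((p + 1) * q) • (v * B u w)) ?_ ?_ ?_ hu
    · intro a
      rw [b1, b1, b1, contractLeft_mul _ hv, zero_add, one_mul, neg_mul, mul_neg, smul_neg,
        neg_add]
    · intro p u u' h h'
      simp only [map_add, LinearMap.add_apply, h, h', add_mul, mul_add, smul_add]
      abel
    · intro p y u hu h
      have e1 : ι A y * (v * B u w) = (-1 : ℤ) ^ q • (v * (ι A y * B u w)) := by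
        rw [← mul_assoc, ι_mul_eq_involute_mul, involute_of_mem hv, smul_mul_assoc,
          smul_mul_assoc, mul_assoc]
      have e2 : u * (v * lam y w) = (-1 : ℤ) ^ (p * q) • (v * (u * lam y w)) := by
        rw [← mul_assoc, graded_comm hu hv, smul_mul_assoc, mul_assoc]
      rw [b2, b2, b2, h, lmul, involute_of_mem hu]
      simp only [mul_add, add_mul, smul_mul_assoc, mul_smul_comm, smul_add, e1, e2, smul_smul,
        mul_assoc, ← pow_add]
      rw [show p * q + 1 * q + 1 * q + p = p + p * q + 2 * q by ring, pow_add _ (p + p * q),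
        pow_mul _ 2]
      simp only [neg_one_sq, one_pow, mul_one, one_mul]
      abel
  have skew_alg : ∀ (q : ℕ) (v : ExteriorAlgebra A L) (_ : v ∈ ⋀[A]^q L) (a : A),
      B v (algebraMap A _ a) = (-1 : ℤ) ^ (q + 1) • CliffordAlgebra.contractLeft (dual a) v := by
    intro q v hv a
    refine extPow_induction (P := fun q v =>
      B v (algebraMap A _ a) = (-1 : ℤ) ^ (q + 1) • CliffordAlgebra.contractLeft (dual a) v)
      ?_ ?_ ?_ hv
    · intro b
      rw [b1, CliffordAlgebra.contractLeft_algebraMap, CliffordAlgebra.contractLeft_algebraMap,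
        neg_zero, smul_zero]
    · intro p u u' h h'
      rw [map_add, LinearMap.add_apply, h, h', map_add, smul_add]
    · intro p y u hu h
      rw [b2, h, l1, CliffordAlgebra.contractLeft_ι_mul, involute_of_mem hu, smul_mul_assoc,
        ← Algebra.commutes, ← Algebra.smul_def, mul_smul_comm, smul_sub,
        show p + 1 + 1 = p + 2 by ring, pow_add, pow_add]
      change _ = ((-1 : ℤ) ^ p * (-1) ^ 2) • (⁅y, a⁆ • u) - _
      simp only [neg_one_sq, pow_one, mul_one, mul_neg_one, neg_smul]
      abel
  have skew_ι : ∀ (q : ℕ) (v : ExteriorAlgebra A L) (_ : v ∈ ⋀[A]^q L) (y : L),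
      B v (ι A y) = -lam y v := by
    intro q v hv y
    refine extPow_induction (P := fun q v => B v (ι A y) = -lam y v) ?_ ?_ ?_ hv
    · intro b
      rw [b1, l1, CliffordAlgebra.contractLeft_ι]
      rfl
    · intro p u u' h h'
      rw [map_add, LinearMap.add_apply, h, h', map_add, neg_add]
    · intro p z u hu h
      rw [b2, h, l2, l3, ← ι_mul_eq_involute_mul, ← lie_skew z y, map_neg, neg_mul, mul_neg,
        neg_add]
  refine ⟨B, ?_, ?_, ?_, ?_, ?_, lie_mul⟩
  · intro a b
    rw [b1, CliffordAlgebra.contractLeft_algebraMap, neg_zero]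
  · intro x a; rw [b3, l1]
  · intro x y; rw [b3, l3]
  · intro p q m hpq u v hu hv
    have main : (p + q = 0 → B u v = 0) ∧ ∀ m, p + q = m + 1 → B u v ∈ ⋀[A]^m L := by
      refine extPow_induction (P := fun p u =>
        (p + q = 0 → B u v = 0) ∧ ∀ m, p + q = m + 1 → B u v ∈ ⋀[A]^m L) ?_ ?_ ?_ hu
      · intro a
        rw [b1]
        refine ⟨fun h => ?_, fun m hm => ?_⟩
        · obtain rfl : q = 0 := by omega
          obtain ⟨b, rfl⟩ := mem_zero_iff.1 hv
          rw [CliffordAlgebra.contractLeft_algebraMap, neg_zero]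
        · exact neg_mem (contractLeft_mem _ hv m (by omega))
      · rintro p u u' ⟨h1, h2⟩ ⟨h1', h2'⟩
        refine ⟨fun h => ?_, fun m hm => ?_⟩
        · rw [map_add, LinearMap.add_apply, h1 h, h1' h, add_zero]
        · rw [map_add, LinearMap.add_apply]; exact add_mem (h2 m hm) (h2' m hm)
      · rintro p y u hu ⟨h1, h2⟩
        refine ⟨fun h => by omega, fun m hm => ?_⟩
        rw [b2]
        refine add_mem ?_ ?_
        · rcases m with _ | m
          · rw [h1 (by omega), mul_zero]; exact zero_mem _
          · exact ι_mul_mem _ (h2 m (by omega))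
        · have hm' : m = p + q := by omega
          subst hm'
          rw [involute_of_mem hu, smul_mul_assoc]
          exact zsmul_mem (SetLike.mul_mem_graded (A := fun i : ℕ => ⋀[A]^i L) hu
            (lmem _ _ _ hv)) _
    exact main.2 m hpq
  · intro p q u v hu hv
    refine extPow_induction (P := fun p u =>
      B u v = -((-1 : ℤ) ^ ((p + 1) * (q + 1)) • B v u)) ?_ ?_ ?_ hu
    · intro a
      rw [skew_alg q v hv, b1, smul_smul, ← pow_add, zero_add, one_mul,
        Even.neg_one_pow ⟨q + 1, rfl⟩, one_smul]
    · intro p u u' h h'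
      rw [map_add, LinearMap.add_apply, h, h', map_add, smul_add, neg_add]
    · intro p y u hu h
      rw [b2, h, lie_mul q 1 v (ι A y) u hv (ι_mem y), skew_ι q v hv, involute_of_mem hu, neg_mul,
        graded_comm (lmem y q v hv) hu]
      simp only [smul_add, smul_neg, smul_mul_assoc, mul_smul_comm, mul_neg, neg_add, neg_neg,
        smul_smul, ← pow_add]
      rw [show (p + 1 + 1) * (q + 1) + q * p = p + 2 * (p * q + q + 1) by ring,
        show (p + 1 + 1) * (q + 1) + (q + 1) * 1 = (p + 1) * (q + 1) + 2 * (q + 1) by ring,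
        pow_add _ p, pow_add _ ((p + 1) * (q + 1)), pow_mul _ 2, pow_mul _ 2]
      simp only [neg_one_sq, one_pow, mul_one]
      abel

theorem existsUnique_gerstenhaberBracket : ∃! B, IsGerstenhaberBracket R A L B := by
  obtain ⟨B, hB⟩ := exists_gerstenhaberBracket (R := R) (A := A) (L := L)
  exact ⟨B, hB, fun _ h => h.unique hB⟩

variable (R A L) in
/-- The Gerstenhaber bracket on the exterior `A`-algebra of `L`. -/
def gerstenhaberBracket :
    ExteriorAlgebra A L →ₗ[R] ExteriorAlgebra A L →ₗ[R] ExteriorAlgebra A L :=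
  (existsUnique_gerstenhaberBracket (R := R) (A := A) (L := L)).choose

theorem isGerstenhaberBracket_gerstenhaberBracket :
    IsGerstenhaberBracket R A L (gerstenhaberBracket R A L) :=
  (existsUnique_gerstenhaberBracket (R := R) (A := A) (L := L)).choose_spec.1

variable (R A L) in
/-- A generator of the Gerstenhaber bracket: an `R`-linear operator `D` of degree `-1` on the
exterior algebra such that `[u, v] = (-1)^p (D (u v) - (D u) v - (-1)^p u (D v))` for `u` of
degree `p`. -/
@[ext]
structure Generator where
  /-- The underlying operator. -/
  toLinearMap : ExteriorAlgebra A L →ₗ[R] ExteriorAlgebra A L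
  map_mem (p : ℕ) (u : ExteriorAlgebra A L) (hu : u ∈ ⋀[A]^(p + 1) L) :
    toLinearMap u ∈ ⋀[A]^p L
  map_zero_degree (u : ExteriorAlgebra A L) (hu : u ∈ ⋀[A]^0 L) : toLinearMap u = 0
  generates (p q : ℕ) (u v : ExteriorAlgebra A L) (hu : u ∈ ⋀[A]^p L) (hv : v ∈ ⋀[A]^q L) :
    gerstenhaberBracket R A L u v = (-1 : ℤ) ^ p •
      (toLinearMap (u * v) - toLinearMap u * v - (-1 : ℤ) ^ p • (u * toLinearMap v))

/-- A generator is exact if it squares to zero. -/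
def Generator.IsExact (D : Generator R A L) : Prop :=
  ∀ u, D.toLinearMap (D.toLinearMap u) = 0

/-- The component `Λ^(p+1) L → Λ^p L` of a generator. -/
def Generator.component (D : Generator R A L) (p : ℕ) (u : ⋀[A]^(p + 1) L) : ⋀[A]^p L :=
  ⟨D.toLinearMap u, D.map_mem p u u.2⟩

variable (R A L) in
/-- An `(A, L)`-connection on an `A`-module `M`: an operation `(x, m) ↦ ∇ x m` of `L` on `M` that is
`A`-linear in `x`, `R`-linear in `m`, and satisfies `∇ x (a m) = a (∇ x m) + x(a) m`. -/
@[ext]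
structure Connection (M : Type*) [AddCommGroup M] [Module R M] [Module A M]
    [IsScalarTower R A M] where
  /-- The underlying operation. -/
  toLinearMap : L →ₗ[A] M →ₗ[R] M
  leibniz (x : L) (a : A) (m : M) :
    toLinearMap x (a • m) = a • toLinearMap x m + ⁅x, a⁆ • m

section Connection

variable {M : Type*} [AddCommGroup M] [Module R M] [Module A M] [IsScalarTower R A M]

/-- A connection on `M` is flat, that is, a left `(A, L)`-module structure on `M`, if it is a
representation of the Lie algebra `L`. -/
def Connection.IsFlat (nabla : Connection R A L M) : Prop :=
  ∀ (x y : L) (m : M), nabla.toLinearMap ⁅x, y⁆ m =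
    nabla.toLinearMap x (nabla.toLinearMap y m) - nabla.toLinearMap y (nabla.toLinearMap x m)

/-- The sum `∑_{i < j} (-1)^(i+j) f ([ξ_i, ξ_j], ξ_0, …, ξ̂_i, …, ξ̂_j, …, ξ_k)` for an alternating
form `f` in `k` arguments; it is empty for `k = 0`. The pairs `i < j` of indices in
`Fin (k + 2)` are the pairs `(i.castSucc, j.succ)` with `i ≤ j` in `Fin (k + 1)`. -/
def bracketSum : {k : ℕ} → (L [⋀^Fin k]→ₗ[A] M) → (Fin (k + 1) → L) → M
  | 0, _, _ => 0
  | k + 1, f, ξ => ∑ i : Fin (k + 1), ∑ j ∈ Finset.Ici i, (-1 : ℤ) ^ ((i : ℕ) + (j + 1 : ℕ)) •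
      f (Fin.cons (α := fun _ : Fin (k + 1) => L) ⁅ξ i.castSucc, ξ j.succ⁆
        (j.removeNth (i.castSucc.removeNth ξ)))

/-- The operator of covariant derivative of a connection, on an alternating form `f` in `k`
arguments that is regarded as having degree `p`:
`(d f)(ξ_0, …, ξ_k) = (-1)^(p+1) (∑_i (-1)^i ∇_{ξ_i} (f (ξ_0, …, ξ̂_i, …, ξ_k))
  + ∑_{i < j} (-1)^(i+j) f ([ξ_i, ξ_j], ξ_0, …, ξ̂_i, …, ξ̂_j, …, ξ_k))`. -/
def Connection.covariantDerivative (nabla : Connection R A L M) (p : ℕ) {k : ℕ}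
    (f : L [⋀^Fin k]→ₗ[A] M) (ξ : Fin (k + 1) → L) : M :=
  (-1 : ℤ) ^ (p + 1) •
    (∑ i : Fin (k + 1), (-1 : ℤ) ^ (i : ℕ) • nabla.toLinearMap (ξ i) (f (i.removeNth ξ))
      + bracketSum f ξ)

end Connection

/-- The adjoint `φ : Λ^p L → Alt^k(L, Λ^n L)`, where `p + k = n`, of the wedge pairing:
`φ_α (ξ_1, …, ξ_k) = α ∧ ξ_1 ∧ ⋯ ∧ ξ_k`. -/
def wedgeAdjoint {A L : Type*} [CommRing A] [AddCommGroup L] [Module A L] {p k n : ℕ}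
    (h : p + k = n) : ⋀[A]^p L →ₗ[A] (L [⋀^Fin k]→ₗ[A] ⋀[A]^n L) where
  toFun α := ((LinearMap.mulLeft A (α : ExteriorAlgebra A L)).compAlternatingMap
      (ιMulti A k)).codRestrict (⋀[A]^n L) fun ξ => by
    subst h
    exact SetLike.mul_mem_graded (A := fun i : ℕ => ⋀[A]^i L) α.2
      (ExteriorAlgebra.ιMulti_range A k ⟨ξ, rfl⟩)
  map_add' α β := by
    ext ξ
    exact add_mul _ _ _
  map_smul' a α := by
    ext ξ
    exact smul_mul_assoc _ _ _

theorem coe_wedgeAdjoint_apply {A L : Type*} [CommRing A] [AddCommGroup L] [Module A L]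
    {p k n : ℕ} (h : p + k = n) (α : ⋀[A]^p L) (ξ : Fin k → L) :
    (wedgeAdjoint h α ξ : ExteriorAlgebra A L) = α * ιMulti A k ξ := rfl

variable (R A) in
/-- The Lie derivative `λ_x` on `Λ^n L`, that is, the bracket with `x`; see
`lieDerivative_ιMulti` for its value on `ξ_1 ∧ ⋯ ∧ ξ_n`. -/
def lieDerivative (n : ℕ) (x : L) : ⋀[A]^n L →ₗ[R] ⋀[A]^n L where
  toFun ω := ⟨gerstenhaberBracket R A L (ι A x) ω,
    isGerstenhaberBracket_gerstenhaberBracket.lie_mem 1 n n (add_comm 1 n) _ _ (ι_mem x) ω.2⟩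
  map_add' _ _ := Subtype.ext (map_add _ _ _)
  map_smul' _ _ := Subtype.ext (map_smul _ _ _)

theorem lieDerivative_ιMulti (n : ℕ) (x : L) (ξ : Fin n → L) :
    lieDerivative R A n x (exteriorPower.ιMulti A n ξ) =
      ∑ j, exteriorPower.ιMulti A n (Function.update ξ j ⁅x, ξ j⁆) := by
  have key : ∀ (n : ℕ) (ξ : Fin n → L), gerstenhaberBracket R A L (ι A x) (ιMulti A n ξ) =
      ∑ j, ιMulti A n (Function.update ξ j ⁅x, ξ j⁆) := by
    intro n
    induction n with
    | zero =>
      intro ξ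
      have h0 := lie_algebraMap_eq_zero (A := A) x (1 : R)
      rw [map_one] at h0
      rw [ιMulti_zero_apply, ← map_one (algebraMap A (ExteriorAlgebra A L)),
        isGerstenhaberBracket_gerstenhaberBracket.lie_ι_algebraMap, h0, map_zero]
      rfl
    | succ n ih =>
      intro ξ
      have e0 : Matrix.vecTail (Function.update ξ 0 ⁅x, ξ 0⁆) = Matrix.vecTail ξ := by
        ext i; simp [Matrix.vecTail]
      have e1 : ∀ i : Fin n, Matrix.vecTail (Function.update ξ i.succ ⁅x, ξ i.succ⁆) =
          Function.update (Matrix.vecTail ξ) i ⁅x, Matrix.vecTail ξ i⁆ := by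
        intro i
        ext j
        simp [Matrix.vecTail, Function.update_apply]
      rw [ιMulti_succ_apply, isGerstenhaberBracket_gerstenhaberBracket.lie_mul 1 1 _ _ _
        (ι_mem x) (ι_mem (ξ 0)), isGerstenhaberBracket_gerstenhaberBracket.lie_ι_ι, ih,
        Fin.sum_univ_succ, ιMulti_succ_apply, e0, Finset.mul_sum]
      simp only [ιMulti_succ_apply, e1]
      simp [Fin.succ_ne_zero, eq_comm]
  apply Subtype.ext
  rw [AddSubmonoidClass.coe_finsetSum]
  exact key n ξ

/-- The relation `φ_{D α} = -d^∇ (φ_α)` for all homogeneous `α` in the exterior algebra, where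
`φ_α` is regarded as having the degree `p` of `α`. For `p = 0` the left-hand side is zero since
`D α` lies in `Λ^{-1} L = 0`. For `p > n` there is nothing to compare, since `Λ^p L` is zero when
`L` has rank `n`. -/
structure Corresponds (n : ℕ) (D : Generator R A L)
    (nabla : Connection R A L (⋀[A]^n L)) : Prop where
  degree_zero (α : ⋀[A]^0 L) (ξ : Fin (n + 1) → L) :
    0 = -nabla.covariantDerivative 0 (wedgeAdjoint (zero_add n) α) ξ
  degree_succ (p k : ℕ) (h : p + 1 + k = n) (h' : p + (k + 1) = n) (α : ⋀[A]^(p + 1) L)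
    (ξ : Fin (k + 1) → L) : wedgeAdjoint h' (D.component p α) ξ =
      -nabla.covariantDerivative (p + 1) (wedgeAdjoint h α) ξ

/-- The relation `(D x) ω = λ_x ω - ∇_x ω` for `x` in `L` and `ω` in `Λ^n L`. Here `D x` lies in
`Λ^0 L = A`, so that the product in the exterior algebra is the scalar action on `Λ^n L`. -/
def LieCorresponds (n : ℕ) (D : Generator R A L)
    (nabla : Connection R A L (⋀[A]^n L)) : Prop :=
  ∀ (x : L) (ω : ⋀[A]^n L), D.toLinearMap (ι A x) * (ω : ExteriorAlgebra A L) =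
    (lieDerivative R A n x ω - nabla.toLinearMap x ω : ⋀[A]^n L)

end LieRinehart

end

/-! Everything about a generator `D` is contained in its divergence `δ x = D x`, a map from `L` to
`A`. Taking `u = x` in the defining identity gives `D (x ∧ u) = δ(x) u - x ∧ D u - [x, u]`
(`Generator.map_ι_mul`), so `δ` determines `D` by induction on degree. It obeys `δ(a x) = a δ(x) -
x(a)`, and every additive `δ` with this rule comes from a generator
(`exists_generator_of_divergence`).

A connection on `Λ^n L` amounts to the same datum. Since `Λ^(n+1) L = 0`, the Lie derivative in top
degree satisfies `λ_{ax} ω = a λ_x ω - x(a) ω`. For a connection `∇`, the operator `λ_x - ∇_x` is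
therefore `A`-linear on `Λ^n L`, hence multiplication by a unique scalar `δ(x)` (the case `p = 0` of
the isomorphism `φ`), and `δ` obeys the rule above. Thus `λ_x - ∇_x = D x` defines the bijection
(`toConnection_bijective`).

That `φ` is bijective is clear from bases when `L` is free. In general, `L` is free up to
multiplication by each `f` in a family generating the unit ideal, and both injectivity and
surjectivity can be tested after multiplication by powers of such `f`.

To compare with `φ_{Dα} = -d^∇ φ_α`, apply the recursion to `x ∧ ω = 0` with `ω` of top degree: the
relation becomes `∇_x ω = -x ∧ D ω`. Substituting this in `d^∇ φ_α` gives an alternating sum of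
terms `ξ_i ∧ D(…)`, evaluated by `Generator.sum_ι_mul_map`; the bracket terms cancel and only `±ξ_0
∧ ⋯ ∧ ξ_k ∧ Dα` survives. Conversely, top degree `α` already suffices to recover the relation with
`λ`.

Exactness and flatness are both equivalent to the vanishing of `K(x, y) = y(δ x) - x(δ y) + δ[x,
y]`: the curvature of `∇` is multiplication by `K`, while `D² (x ∧ y) = -K(x, y)`. If `K = 0`, then
`D²` commutes with left multiplication by each `x`, so it vanishes by induction. -/

noncomputable section

namespace LieRinehart

open ExteriorAlgebra

/-! ### The wedge pairing for a free module. -/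

section FreeModule

variable {A L : Type*} [CommRing A] [AddCommGroup L] [Module A L] {p k : ℕ}

-- The unit is the sign of the permutation that sorts the two complementary index sets into one.
open Set.powersetCard in
theorem exists_unit_ιMulti_family_mul_compl (b : Module.Basis (Fin (p + k)) A L)
    (s : Set.powersetCard (Fin (p + k)) k) (t : Set.powersetCard (Fin (p + k)) (p + k)) :
    ∃ c : ℤˣ, exteriorPower.ιMulti_family A p b
        (compl (Fintype.card_fin (p + k)).symm s) *
        (exteriorPower.ιMulti_family A k b s : ExteriorAlgebra A L) =
      c • (exteriorPower.ιMulti_family A (p + k) b t : ExteriorAlgebra A L) := by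
  have hd : Disjoint (compl (m := p) (Fintype.card_fin (p + k)).symm s).val s.val := by
    rw [show (compl (m := p) (Fintype.card_fin (p + k)).symm s).val = s.valᶜ from rfl]
    exact disjoint_compl_left
  refine ⟨(permOfDisjoint hd).sign, ?_⟩
  have : t = disjUnion hd := by
    have h1 : ∀ u : Set.powersetCard (Fin (p + k)) (p + k), u.val = Finset.univ := fun u =>
      Finset.card_eq_iff_eq_univ _ |>.1 (by rw [u.prop, Fintype.card_fin])
    exact Subtype.ext ((h1 t).trans (h1 _).symm)
  rw [this]
  exact ιMulti_family_mul_of_disjoint A b _ s hd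

-- By cardinality, disjoint index sets of sizes `p` and `k` in a set of `p + k` elements are
-- complementary; otherwise a basis vector is repeated.
open Set.powersetCard in
theorem ιMulti_family_mul_eq_zero (b : Module.Basis (Fin (p + k)) A L)
    (s : Set.powersetCard (Fin (p + k)) k) (t : Set.powersetCard (Fin (p + k)) p)
    (h : t ≠ compl (Fintype.card_fin (p + k)).symm s) :
    exteriorPower.ιMulti_family A p b t *
      (exteriorPower.ιMulti_family A k b s : ExteriorAlgebra A L) = 0 := by
  refine ιMulti_family_mul_of_not_disjoint A b t s fun hd => h ?_
  rw [eq_iff_subset]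
  intro i hi
  exact Finset.mem_compl.2 fun hi' => Finset.disjoint_left.1 hd hi hi'

/-- Evaluating `φ_α` on the basis vectors indexed by `s` isolates the coordinate of `α` at the
complement of `s`. Both injectivity and surjectivity in the free case follow from this. -/
theorem wedgeAdjoint_ιMulti_family (b : Module.Basis (Fin (p + k)) A L) (α : ⋀[A]^p L)
    (s : Set.powersetCard (Fin (p + k)) k) :
    ((wedgeAdjoint rfl α (b ∘ Set.powersetCard.ofFinEmbEquiv.symm s) : ⋀[A]^(p + k) L) :
      ExteriorAlgebra A L) =
    (b.exteriorPower p).repr α (Set.powersetCard.compl (Fintype.card_fin (p + k)).symm s) •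
      ((exteriorPower.ιMulti_family A p b
        (Set.powersetCard.compl (Fintype.card_fin (p + k)).symm s) : ExteriorAlgebra A L) *
        (exteriorPower.ιMulti_family A k b s : ExteriorAlgebra A L)) := by
  rw [coe_wedgeAdjoint_apply]
  conv_lhs => rw [← (b.exteriorPower p).sum_repr α]
  rw [AddSubmonoidClass.coe_finsetSum, Finset.sum_mul, Finset.sum_eq_single
    (Set.powersetCard.compl (Fintype.card_fin (p + k)).symm s)]
  · rw [exteriorPower.basis_apply, SetLike.val_smul, smul_mul_assoc]
    rfl
  · intro t _ ht
    rw [exteriorPower.basis_apply, SetLike.val_smul, smul_mul_assoc]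
    have := ιMulti_family_mul_eq_zero b s t ht
    rw [show (exteriorPower.ιMulti_family A k b s : ExteriorAlgebra A L) =
      ιMulti A k (b ∘ Set.powersetCard.ofFinEmbEquiv.symm s) from rfl] at this
    rw [this, smul_zero]
  · intro h
    exact absurd (Finset.mem_univ _) h

theorem wedgeAdjoint_bijective_of_basis {n : ℕ} (h : p + k = n) (b : Module.Basis (Fin n) A L) :
    Function.Bijective (wedgeAdjoint (A := A) (L := L) h) := by
  subst h
  let t : Set.powersetCard (Fin (p + k)) (p + k) := ⟨Finset.univ, by
    rw [Set.powersetCard.mem_iff, Finset.card_univ, Fintype.card_fin]⟩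
  have ht : ∀ u, u = t := fun u => Subtype.ext
    (Finset.card_eq_iff_eq_univ _ |>.1 (by rw [u.prop, Fintype.card_fin]))
  constructor
  · rw [injective_iff_map_eq_zero]
    intro α hα
    refine (b.exteriorPower p).ext_elem fun s => ?_
    obtain ⟨s, rfl⟩ := (Set.powersetCard.compl (m := p) (Fintype.card_fin (p + k)).symm).surjective s
    have := wedgeAdjoint_ιMulti_family b α s
    obtain ⟨c, hc⟩ := exists_unit_ιMulti_family_mul_compl b s t
    rw [hα, hc, AlternatingMap.zero_apply, ZeroMemClass.coe_zero, smul_comm, eq_comm,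
      smul_eq_zero_iff_eq] at this
    rw [map_zero, Finsupp.zero_apply]
    have h2 : (b.exteriorPower p).repr α (Set.powersetCard.compl (Fintype.card_fin (p + k)).symm s) •
      b.exteriorPower (p + k) t = 0 := by
      rw [exteriorPower.basis_apply]
      exact Subtype.ext this
    have h3 := congrArg (fun x => (b.exteriorPower (p + k)).repr x t) h2
    simpa using h3
  · intro g
    choose c hc using fun s => exists_unit_ιMulti_family_mul_compl b s t
    let G := exteriorPower.alternatingMapLinearEquiv g
    let co : Set.powersetCard (Fin (p + k)) k → A := fun s =>
      (b.exteriorPower (p + k)).repr (g (b ∘ Set.powersetCard.ofFinEmbEquiv.symm s)) t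
    let e := Set.powersetCard.compl (α := Fin (p + k)) (n := k) (m := p)
      (Fintype.card_fin (p + k)).symm
    -- The coordinate at the complement of `s` is the value of `g` at `s`, corrected by the sign `c
    -- s`, which is its own inverse.
    let α := (b.exteriorPower p).equivFun.symm fun u => (c (e.symm u) : ℤ) • co (e.symm u)
    refine ⟨α, exteriorPower.alternatingMapLinearEquiv.injective
      ((b.exteriorPower k).ext fun s => ?_)⟩
    rw [exteriorPower.basis_apply]
    change exteriorPower.alternatingMapLinearEquiv _ (exteriorPower.ιMulti A k
      (b ∘ Set.powersetCard.ofFinEmbEquiv.symm s)) = exteriorPower.alternatingMapLinearEquiv _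
      (exteriorPower.ιMulti A k (b ∘ Set.powersetCard.ofFinEmbEquiv.symm s))
    rw [exteriorPower.alternatingMapLinearEquiv_apply_ιMulti,
      exteriorPower.alternatingMapLinearEquiv_apply_ιMulti]
    apply Subtype.ext
    rw [wedgeAdjoint_ιMulti_family, hc]
    have h1 : (b.exteriorPower p).repr α (e s) = (c s : ℤ) • co s := by
      rw [← Module.Basis.equivFun_apply, LinearEquiv.apply_symm_apply, Equiv.symm_apply_apply]
    have h2 : g (b ∘ Set.powersetCard.ofFinEmbEquiv.symm s) =
        co s • exteriorPower.ιMulti_family A (p + k) b t := by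
      have := (b.exteriorPower (p + k)).sum_repr (g (b ∘ Set.powersetCard.ofFinEmbEquiv.symm s))
      rw [Finset.sum_eq_single t (fun u _ hu => absurd (ht u) hu)
        (fun h => absurd (Finset.mem_univ _) h), exteriorPower.basis_apply] at this
      exact this.symm
    change (b.exteriorPower p).repr α (e s) • _ = _
    rw [h1, h2, SetLike.val_smul, Units.smul_def, smul_assoc, smul_comm (co s), smul_smul,
      ← Units.val_mul, Int.units_mul_self, Units.val_one, one_smul]

theorem eq_zero_of_mem_extPow_of_basis {n m : ℕ} (b : Module.Basis (Fin n) A L) (h : n < m)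
    {u : ExteriorAlgebra A L} (hu : u ∈ ⋀[A]^m L) : u = 0 := by
  have : IsEmpty (Set.powersetCard (Fin n) m) := ⟨fun s => by
    have := s.val.card_le_univ
    rw [s.prop, Fintype.card_fin] at this
    omega⟩
  have h0 := (b.exteriorPower m).ext_elem (x := ⟨u, hu⟩) (y := 0) fun s => this.elim s
  exact congrArg Subtype.val h0

end FreeModule

/-! ### Passage from free modules to projective modules of constant rank. -/

section Local

variable {A L : Type*} [CommRing A] [AddCommGroup L] [Module A L]

/-- Serves to count denominators: maps that are mutually inverse up to `f` induce maps on `Λ^m` that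
are mutually inverse up to `f ^ m`. -/
theorem map_smul_id {m : ℕ} (f : A) {u : ExteriorAlgebra A L} (hu : u ∈ ⋀[A]^m L) :
    ExteriorAlgebra.map (f • LinearMap.id) u = f ^ m • u := by
  refine extPow_induction (P := fun m u => ExteriorAlgebra.map (f • LinearMap.id) u = f ^ m • u)
    ?_ ?_ ?_ hu
  · intro a; rw [AlgHom.commutes, pow_zero, one_smul]
  · intro p u v hu hv; rw [map_add, hu, hv, smul_add]
  · intro p y u _ hu
    rw [map_mul, hu, map_apply_ι, LinearMap.smul_apply, LinearMap.id_apply, map_smul,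
      smul_mul_smul_comm, pow_succ']

theorem map_mem {N : Type*} [AddCommGroup N] [Module A N] (g : L →ₗ[A] N) {m : ℕ}
    {u : ExteriorAlgebra A L} (hu : u ∈ ⋀[A]^m L) : ExteriorAlgebra.map g u ∈ ⋀[A]^m N := by
  refine extPow_induction (P := fun m u => ExteriorAlgebra.map g u ∈ ⋀[A]^m N) ?_ ?_ ?_ hu
  · intro a; rw [AlgHom.commutes]; exact mem_zero_iff.2 ⟨a, rfl⟩
  · intro p u v hu hv; rw [map_add]; exact add_mem hu hv
  · intro p y u _ hu; rw [map_mul, map_apply_ι]; exact ι_mul_mem _ hu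

/-- `L` is free of rank `n` up to multiplication by `f`. -/
def IsFreeUpTo (L : Type*) [AddCommGroup L] [Module A L] (n : ℕ) (f : A) : Prop :=
  ∃ (h : (Fin n → A) →ₗ[A] L) (θ : L →ₗ[A] (Fin n → A)),
    h ∘ₗ θ = f • LinearMap.id ∧ θ ∘ₗ h = f • LinearMap.id

/-- The localization at `P` is free of rank `n`. By finite presentation, the isomorphism with the
free module and its inverse lift to maps over `A` after clearing denominators, and the lifts are
mutually inverse after a further multiplication. -/
theorem exists_isFreeUpTo [Module.Finite A L] [Module.Projective A L] {n : ℕ}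
    (P : PrimeSpectrum A) (hn : Module.rankAtStalk L P = n) :
    ∃ f ∉ P.asIdeal, IsFreeUpTo L n f := by
  let S := P.asIdeal.primeCompl
  have hfp : Module.FinitePresentation A L := Module.finitePresentation_of_projective A L
  have hflat : Module.Flat (Localization.AtPrime P.asIdeal) (LocalizedModule S L) := inferInstance
  have hfree : Module.Free (Localization.AtPrime P.asIdeal) (LocalizedModule S L) :=
    Module.free_of_flat_of_isLocalRing
  let b := Module.finBasisOfFinrankEq (Localization.AtPrime P.asIdeal) (LocalizedModule S L) hn
  let φL := LocalizedModule.mkLinearMap S L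
  let φF : (Fin n → A) →ₗ[A] (Fin n → Localization.AtPrime P.asIdeal) :=
    LinearMap.pi fun i => Algebra.linearMap A (Localization.AtPrime P.asIdeal) ∘ₗ LinearMap.proj i
  have hφF : IsLocalizedModule S φF :=
    inferInstanceAs (IsLocalizedModule S (LinearMap.pi fun i =>
      Algebra.linearMap A (Localization.AtPrime P.asIdeal) ∘ₗ LinearMap.proj i))
  let e : (Fin n → Localization.AtPrime P.asIdeal) ≃ₗ[A] LocalizedModule S L :=
    b.equivFun.symm.restrictScalars A
  obtain ⟨h, s, hs⟩ := Module.FinitePresentation.exists_lift_of_isLocalizedModule S φL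
    (e.toLinearMap ∘ₗ φF)
  obtain ⟨θ, t, ht⟩ := Module.FinitePresentation.exists_lift_of_isLocalizedModule S φF
    (e.symm.toLinearMap ∘ₗ φL)
  have hs' : ∀ v, φL (h v) = (s : A) • e (φF v) := fun v => LinearMap.congr_fun hs v
  have ht' : ∀ v, φF (θ v) = (t : A) • e.symm (φL v) := fun v => LinearMap.congr_fun ht v
  have h1 : φL ∘ₗ (h ∘ₗ θ) = φL ∘ₗ (((s : A) * t) • LinearMap.id) := by
    ext x
    change φL (h (θ x)) = φL (((s : A) * t) • x)
    rw [hs', ht', map_smul, e.apply_symm_apply, map_smul, smul_smul]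
  have h2 : φF ∘ₗ (θ ∘ₗ h) = φF ∘ₗ (((s : A) * t) • LinearMap.id) := by
    refine LinearMap.ext fun x => ?_
    change φF (θ (h x)) = φF (((s : A) * t) • x)
    rw [ht', hs', map_smul, e.symm_apply_apply, map_smul, smul_smul, mul_comm]
  obtain ⟨r1, h1⟩ := Module.Finite.exists_smul_of_comp_eq_of_isLocalizedModule S φL _ _ h1
  obtain ⟨r2, h2⟩ := Module.Finite.exists_smul_of_comp_eq_of_isLocalizedModule S φF _ _ h2
  have h1' : (r1 : A) • (h ∘ₗ θ) = (r1 : A) • (((s : A) * t) • LinearMap.id) := h1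
  have h2' : (r2 : A) • (θ ∘ₗ h) = (r2 : A) • (((s : A) * t) • LinearMap.id) := h2
  -- Scaling `θ` by `r1 * r2` absorbs the denominators of both composites, so that one `f` serves
  -- both identities.
  refine ⟨(r1 * r2 * (s * t) : S), (r1 * r2 * (s * t) : S).2, h, ((r1 : A) * r2) • θ, ?_, ?_⟩
  · rw [LinearMap.comp_smul, mul_comm, mul_smul, h1', smul_smul, smul_smul]
    congr 1; push_cast; ring
  · rw [LinearMap.smul_comp, mul_smul, h2', smul_smul, smul_smul]
    rfl

/-- No maximal ideal can contain all such `f`, by `exists_isFreeUpTo` at that ideal. -/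
theorem span_isFreeUpTo [Module.Finite A L] [Module.Projective A L] {n : ℕ}
    (hn : ∀ P : PrimeSpectrum A, Module.rankAtStalk L P = n) :
    Ideal.span {f : A | IsFreeUpTo L n f} = ⊤ := by
  by_contra hne
  obtain ⟨m, hm, hle⟩ := Ideal.exists_le_maximal _ hne
  obtain ⟨f, hf, hf'⟩ := exists_isFreeUpTo (L := L) ⟨m, hm.isPrime⟩ (hn _)
  exact hf (hle (Ideal.subset_span hf'))

/-- An ideal containing a power of each `f` up to which `L` is free of rank `n` is everything. -/
theorem mem_of_forall_isFreeUpTo [Module.Finite A L] [Module.Projective A L] {n : ℕ}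
    (hn : ∀ P : PrimeSpectrum A, Module.rankAtStalk L P = n) (I : Ideal A) (N : ℕ)
    (h : ∀ f : A, IsFreeUpTo L n f → f ^ N ∈ I) : (1 : A) ∈ I := by
  rw [← Ideal.eq_top_iff_one, eq_top_iff, ← Ideal.span_pow_eq_top _ (span_isFreeUpTo hn) N,
    Ideal.span_le]
  rintro _ ⟨f, hf, rfl⟩
  exact h f hf

theorem map_map_of_comp_eq_smul {N : Type*} [AddCommGroup N] [Module A N] {g : L →ₗ[A] N}
    {h : N →ₗ[A] L} {f : A} (e : h ∘ₗ g = f • LinearMap.id) {m : ℕ} {u : ExteriorAlgebra A L}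
    (hu : u ∈ ⋀[A]^m L) : ExteriorAlgebra.map h (ExteriorAlgebra.map g u) = f ^ m • u := by
  rw [← map_smul_id f hu, ← e, ← map_comp_map]
  rfl

variable [Module.Finite A L] [Module.Projective A L] {n : ℕ}

/-- The multiple `f ^ m • u` factors through `Λ^m` of a free module of rank `n`, which is zero; such
`f ^ m` generate the unit ideal. -/
theorem eq_zero_of_mem_extPow (hn : ∀ P : PrimeSpectrum A, Module.rankAtStalk L P = n) {m : ℕ}
    (h : n < m) {u : ExteriorAlgebra A L} (hu : u ∈ ⋀[A]^m L) : u = 0 := by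
  have := mem_of_forall_isFreeUpTo hn (LinearMap.ker (LinearMap.toSpanSingleton A _ u)) m
    fun f ⟨g, θ, h1, _⟩ => by
      rw [LinearMap.mem_ker, LinearMap.toSpanSingleton_apply, ← map_map_of_comp_eq_smul h1 hu,
        eq_zero_of_mem_extPow_of_basis (Pi.basisFun A (Fin n)) h (map_mem θ hu), map_zero]
  rwa [LinearMap.mem_ker, LinearMap.toSpanSingleton_apply, one_smul] at this

/-- The annihilator of `α` in the kernel contains every `f ^ n`: a factor `f ^ k` is spent on the
arguments `ξ` and a factor `f ^ p` on `α`. -/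
theorem wedgeAdjoint_injective (hn : ∀ P : PrimeSpectrum A, Module.rankAtStalk L P = n) {p k : ℕ}
    (h : p + k = n) : Function.Injective (wedgeAdjoint (A := A) (L := L) h) := by
  rw [injective_iff_map_eq_zero]
  intro α hα
  have := mem_of_forall_isFreeUpTo hn (LinearMap.ker (LinearMap.toSpanSingleton A _ α)) n
    fun f ⟨g, θ, h1, h2⟩ => by
      rw [LinearMap.mem_ker, LinearMap.toSpanSingleton_apply]
      let β : ⋀[A]^p (Fin n → A) := ⟨ExteriorAlgebra.map θ α, map_mem θ α.2⟩
      -- Up to `f ^ k`, the wedge of the `ξ_i` is the image under `θ` of the wedge of the `g ξ_i`,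
      -- so its product with `β` is the image of `φ_α (g ξ) = 0`.
      have hβ : f ^ k • β = 0 := by
        refine (wedgeAdjoint_bijective_of_basis h (Pi.basisFun A (Fin n))).1 ?_
        rw [map_zero]
        ext ξ : 1
        apply Subtype.ext
        rw [coe_wedgeAdjoint_apply, SetLike.val_smul, smul_mul_assoc, ← mul_smul_comm,
          ← map_map_of_comp_eq_smul h2 (ExteriorAlgebra.ιMulti_range A k ⟨ξ, rfl⟩), ← map_mul,
          map_apply_ιMulti, ← coe_wedgeAdjoint_apply h, hα]
        exact map_zero _
      apply Subtype.ext
      rw [← h, add_comm, pow_add, mul_smul, SetLike.val_smul, SetLike.val_smul,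
        ← map_map_of_comp_eq_smul h1 α.2, ← map_smul]
      change ExteriorAlgebra.map g ((f ^ k • β : ⋀[A]^p (Fin n → A)) : _) = 0
      rw [hβ]
      exact map_zero _
  rwa [LinearMap.mem_ker, LinearMap.toSpanSingleton_apply, one_smul] at this

/-- Transport `G` to the free module, take its preimage `β` there and transport `β` back. This hits
`f ^ (n + k) • G`: the factor `f ^ n` comes from the values in `Λ^n` and `f ^ k` from the arguments
of `G`. -/
theorem wedgeAdjoint_surjective (hn : ∀ P : PrimeSpectrum A, Module.rankAtStalk L P = n) {p k : ℕ}
    (h : p + k = n) : Function.Surjective (wedgeAdjoint (A := A) (L := L) h) := by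
  intro G
  have := mem_of_forall_isFreeUpTo hn ((LinearMap.range (wedgeAdjoint (A := A) (L := L) h)).comap
    (LinearMap.toSpanSingleton A _ G)) (n + k) fun f ⟨g, θ, h1, h2⟩ => by
      rw [Submodule.mem_comap, LinearMap.toSpanSingleton_apply]
      obtain ⟨β, hβ⟩ := (wedgeAdjoint_bijective_of_basis h (Pi.basisFun A (Fin n))).2
        ((exteriorPower.map n θ).compAlternatingMap (G.compLinearMap g))
      refine ⟨f ^ k • ⟨ExteriorAlgebra.map g β, map_mem g β.2⟩, ?_⟩
      ext ξ : 1
      apply Subtype.ext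
      have hmap : ∀ w : ⋀[A]^n L, ((exteriorPower.map n θ w : ⋀[A]^n (Fin n → A)) : ExteriorAlgebra A _) =
        ExteriorAlgebra.map θ w := by
        intro w
        have : (Submodule.subtype _).comp (exteriorPower.map n θ) =
            (ExteriorAlgebra.map θ).toLinearMap.comp (Submodule.subtype _) := by
          ext v; simp
        exact LinearMap.congr_fun this w
      have e := congrArg Subtype.val (DFunLike.congr_fun hβ (θ ∘ ξ))
      rw [coe_wedgeAdjoint_apply, LinearMap.compAlternatingMap_apply, hmap,
        AlternatingMap.compLinearMap_apply] at e
      rw [coe_wedgeAdjoint_apply, SetLike.val_smul, smul_mul_assoc, ← mul_smul_comm,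
        ← map_map_of_comp_eq_smul h1 (ExteriorAlgebra.ιMulti_range A k ⟨ξ, rfl⟩), ← map_mul,
        map_apply_ιMulti, e, map_map_of_comp_eq_smul h1 (Subtype.prop _)]
      have e2 : (fun i => g ((θ ∘ ξ) i)) = fun i => f • ξ i := by
        ext i; exact LinearMap.congr_fun h1 (ξ i)
      have e3 := G.map_smul_univ (fun _ : Fin k => f) ξ
      rw [e2, e3, Finset.prod_const, Finset.card_univ, Fintype.card_fin, AlternatingMap.smul_apply,
        SetLike.val_smul, SetLike.val_smul, smul_smul, pow_add]
  rwa [Submodule.mem_comap, LinearMap.toSpanSingleton_apply, one_smul] at this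

end Local

/-! ### Calculus of the Gerstenhaber bracket with elements of degree zero and one. -/

section Bracket

variable {R A L : Type*} [CommRing R] [CommRing A] [Algebra R A] [LieRing L] [LieAlgebra R L]
  [Module A L] [LieRingModule L A] [LieRinehartRing A L] [LieRinehartAlgebra R A L]

theorem algebraMap_mem {A L : Type*} [CommRing A] [AddCommGroup L] [Module A L] (a : A) :
    algebraMap A (ExteriorAlgebra A L) a ∈ ⋀[A]^0 L :=
  mem_zero_iff.2 ⟨a, rfl⟩

theorem extAlg_induction {A L : Type*} [CommRing A] [AddCommGroup L] [Module A L]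
    {P : ExteriorAlgebra A L → Prop} (alg : ∀ a : A, P (algebraMap A _ a))
    (add : ∀ u v, P u → P v → P (u + v)) (ι_mul : ∀ x u, P u → P (ι A x * u))
    (u : ExteriorAlgebra A L) : P u :=
  CliffordAlgebra.left_induction (Q := (0 : QuadraticForm A L)) alg add
    (fun u x hu => ι_mul x u hu) u

theorem lie_one (x : L) : ⁅x, (1 : A)⁆ = 0 := by
  have h := LieRinehartRing.leibniz_mul_right x (1 : A) 1
  simpa using h

theorem bracket_ι_mul (x : L) {q : ℕ} {u : ExteriorAlgebra A L} (hu : u ∈ ⋀[A]^q L)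
    (v : ExteriorAlgebra A L) : gerstenhaberBracket R A L (ι A x) (u * v) =
      gerstenhaberBracket R A L (ι A x) u * v + u * gerstenhaberBracket R A L (ι A x) v := by
  rw [isGerstenhaberBracket_gerstenhaberBracket.lie_mul 1 q _ _ _ (ι_mem x) hu, pow_mul]
  simp

theorem bracket_ι_ι_mul (x y : L) (u : ExteriorAlgebra A L) :
    gerstenhaberBracket R A L (ι A x) (ι A y * u) =
      ι A ⁅x, y⁆ * u + ι A y * gerstenhaberBracket R A L (ι A x) u := by
  rw [bracket_ι_mul x (ι_mem y), isGerstenhaberBracket_gerstenhaberBracket.lie_ι_ι]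

theorem bracket_ι_algebraMap (x : L) (a : A) :
    gerstenhaberBracket R A L (ι A x) (algebraMap A _ a) = algebraMap A _ ⁅x, a⁆ :=
  isGerstenhaberBracket_gerstenhaberBracket.lie_ι_algebraMap x a

theorem bracket_ι_smul (x : L) (a : A) (u : ExteriorAlgebra A L) :
    gerstenhaberBracket R A L (ι A x) (a • u) =
      ⁅x, a⁆ • u + a • gerstenhaberBracket R A L (ι A x) u := by
  rw [Algebra.smul_def, bracket_ι_mul x (algebraMap_mem a), bracket_ι_algebraMap,
    Algebra.smul_def, Algebra.smul_def]

theorem bracket_algebraMap_ι (a : A) (x : L) :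
    gerstenhaberBracket R A L (algebraMap A _ a) (ι A x) = -algebraMap A _ ⁅x, a⁆ := by
  rw [isGerstenhaberBracket_gerstenhaberBracket.lie_skew 0 1 _ _ (algebraMap_mem a) (ι_mem x),
    bracket_ι_algebraMap]
  simp

theorem bracket_algebraMap_ι_mul (a : A) (x : L) (u : ExteriorAlgebra A L) :
    gerstenhaberBracket R A L (algebraMap A _ a) (ι A x * u) =
      -(⁅x, a⁆ • u) - ι A x * gerstenhaberBracket R A L (algebraMap A _ a) u := by
  rw [isGerstenhaberBracket_gerstenhaberBracket.lie_mul 0 1 _ _ _ (algebraMap_mem a) (ι_mem x),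
    bracket_algebraMap_ι, Algebra.smul_def ⁅x, a⁆ u, zero_add, mul_one, pow_one, neg_smul, one_smul,
    neg_mul, ← sub_eq_add_neg]

/-- Both sides are antiderivations that kill `A` and agree on `L`. In particular the bracket with
`a` is `A`-linear. -/
theorem bracket_algebraMap (a : A) (u : ExteriorAlgebra A L) :
    gerstenhaberBracket R A L (algebraMap A _ a) u =
      -CliffordAlgebra.contractLeft (dual a) u := by
  induction u using extAlg_induction with
  | alg r =>
    rw [CliffordAlgebra.contractLeft_algebraMap, neg_zero]
    exact isGerstenhaberBracket_gerstenhaberBracket.lie_algebraMap_algebraMap a r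
  | add u v hu hv => rw [map_add, hu, hv, map_add, neg_add]
  | ι_mul z u hu =>
    rw [CliffordAlgebra.contractLeft_ι_mul]
    refine (bracket_algebraMap_ι_mul a z u).trans ?_
    rw [hu, mul_neg, neg_sub, sub_neg_eq_add, add_comm, ← sub_eq_add_neg]
    rfl

theorem bracket_algebraMap_smul (a b : A) (u : ExteriorAlgebra A L) :
    gerstenhaberBracket R A L (algebraMap A _ a) (b • u) =
      b • gerstenhaberBracket R A L (algebraMap A _ a) u := by
  rw [bracket_algebraMap, bracket_algebraMap, map_smul, smul_neg]

theorem bracket_algebraMap_mul (a b : A) (u : ExteriorAlgebra A L) :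
    gerstenhaberBracket R A L (algebraMap A _ (a * b)) u =
      a • gerstenhaberBracket R A L (algebraMap A _ b) u +
        b • gerstenhaberBracket R A L (algebraMap A _ a) u := by
  have : dual (L := L) (a * b) = a • dual b + b • dual a := by
    ext x
    change ⁅x, a * b⁆ = a * ⁅x, b⁆ + b * ⁅x, a⁆
    rw [LieRinehartRing.leibniz_mul_right, smul_eq_mul, mul_comm b]
  rw [bracket_algebraMap, bracket_algebraMap, bracket_algebraMap, this, map_add, map_smul, map_smul]
  simp only [LinearMap.add_apply, LinearMap.smul_apply, smul_neg, neg_add]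

theorem bracket_algebraMap_algebraMap (r : R) (u : ExteriorAlgebra A L) :
    gerstenhaberBracket R A L (algebraMap A _ (algebraMap R A r)) u = 0 := by
  have h0 : dual (L := L) (algebraMap R A r) = 0 := by
    ext x; exact lie_algebraMap_eq_zero x r
  rw [bracket_algebraMap, h0, map_zero, LinearMap.zero_apply, neg_zero]

theorem smul_lie_eq_sub (a : A) (x y : L) : ⁅a • x, y⁆ = a • ⁅x, y⁆ - ⁅y, a⁆ • x := by
  rw [← lie_skew, LieRinehartRing.leibniz_smul_right, ← lie_skew x y, smul_neg]
  abel

/-- Measures how far the Lie derivative is from being `A`-linear in `x`. In top degree the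
correction becomes a scalar, see `lieDerivative_smul_left`. -/
theorem bracket_ι_smul_left (a : A) (x : L) (u : ExteriorAlgebra A L) :
    gerstenhaberBracket R A L (ι A (a • x)) u = a • gerstenhaberBracket R A L (ι A x) u +
      ι A x * gerstenhaberBracket R A L (algebraMap A _ a) u := by
  induction u using extAlg_induction with
  | alg r =>
    rw [isGerstenhaberBracket_gerstenhaberBracket.lie_algebraMap_algebraMap a r,
      bracket_ι_algebraMap, bracket_ι_algebraMap, LieRinehartRing.lie_smul_eq_mul, mul_zero,
      add_zero, map_mul, Algebra.smul_def]
  | add u v hu hv => simp only [map_add, hu, hv, smul_add, mul_add]; abel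
  | ι_mul z u hu =>
    have sw : ι A x * ι A z = -(ι A z * ι A x) :=
      eq_neg_of_add_eq_zero_left (ExteriorAlgebra.ι_add_mul_swap x z)
    rw [bracket_ι_ι_mul, hu, bracket_ι_ι_mul, bracket_algebraMap_ι_mul, smul_lie_eq_sub, map_sub,
      map_smul, map_smul, sub_mul, smul_mul_assoc, smul_mul_assoc,
      mul_add, mul_sub, ← mul_assoc (ι A x), sw, mul_neg, mul_smul_comm, mul_smul_comm, smul_add,
      neg_mul, mul_assoc]
    abel

/-- A commutator of derivations is a derivation, so it is enough to compare on `A` and `L`. This is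
the only instance of the graded Jacobi identity that is needed. -/
theorem lie_bracket_ι (x y : L) (u : ExteriorAlgebra A L) :
    gerstenhaberBracket R A L (ι A ⁅x, y⁆) u =
      gerstenhaberBracket R A L (ι A x) (gerstenhaberBracket R A L (ι A y) u) -
        gerstenhaberBracket R A L (ι A y) (gerstenhaberBracket R A L (ι A x) u) := by
  induction u using extAlg_induction with
  | alg r =>
    simp only [bracket_ι_algebraMap]
    rw [lie_lie, map_sub]
  | add u v hu hv => simp only [map_add, hu, hv]; abel
  | ι_mul z u hu =>
    simp only [bracket_ι_ι_mul, hu, map_add, lie_lie, map_sub, sub_mul, mul_sub]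
    abel

/-- The derivation rule in the first argument follows from the one in the second by graded
antisymmetry, applied before and after. -/
theorem bracket_ι_mul_left (y : L) {p q : ℕ} {u v : ExteriorAlgebra A L} (hu : u ∈ ⋀[A]^p L)
    (hv : v ∈ ⋀[A]^q L) : gerstenhaberBracket R A L (ι A y * u) v =
      ι A y * gerstenhaberBracket R A L u v +
        (-1 : ℤ) ^ p • (u * gerstenhaberBracket R A L (ι A y) v) := by
  have hB := isGerstenhaberBracket_gerstenhaberBracket (R := R) (A := A) (L := L)
  rw [hB.lie_skew (p + 1) q _ _ (ι_mul_mem y hu) hv, hB.lie_mul q 1 _ _ _ hv (ι_mem y),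
    hB.lie_skew q 1 _ _ hv (ι_mem y), hB.lie_skew q p _ _ hv hu, neg_mul, smul_mul_assoc,
    graded_comm (hB.lie_mem 1 q q (add_comm 1 q) _ _ (ι_mem y) hv) hu]
  simp only [smul_add, smul_neg, mul_smul_comm, mul_neg, neg_add, neg_neg, smul_smul, ← pow_add]
  rw [show (p + 1 + 1) * (q + 1) + ((q + 1) * (1 + 1) + q * p) =
    p + 2 * (p * q + 2 * (q + 1)) by ring,
    show (p + 1 + 1) * (q + 1) + ((q + 1) * 1 + (q + 1) * (p + 1)) = 2 * ((p + 2) * (q + 1)) by ring,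
    pow_add _ p, pow_mul _ 2, pow_mul _ 2]
  simp only [neg_one_sq, one_pow, mul_one, one_smul]
  abel

end Bracket

/-! ### Generators and their divergences. -/

section Generator

variable {R A L : Type*} [CommRing R] [CommRing A] [Algebra R A] [LieRing L] [LieAlgebra R L]
  [Module A L] [LieRingModule L A] [LieRinehartRing A L] [LieRinehartAlgebra R A L]

/-- The value `D x`, as an element of `A`, of a generator on an element `x` of `L`. -/
def Generator.divergence (D : Generator R A L) (x : L) : A :=
  ExteriorAlgebra.algebraMapInv (D.toLinearMap (ι A x))

theorem Generator.map_ι (D : Generator R A L) (x : L) :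
    D.toLinearMap (ι A x) = algebraMap A _ (D.divergence x) := by
  obtain ⟨a, ha⟩ := mem_zero_iff.1 (D.map_mem 0 _ (ι_mem x))
  rw [Generator.divergence, ← ha, ExteriorAlgebra.algebraMap_leftInverse]

theorem Generator.map_algebraMap (D : Generator R A L) (a : A) :
    D.toLinearMap (algebraMap A _ a) = 0 :=
  D.map_zero_degree _ (algebraMap_mem a)

/-- The defining identity with left factor of degree one, solved for `D (x ∧ u)`. As a recursion on
degree it determines `D` from its divergence. -/
theorem Generator.map_ι_mul (D : Generator R A L) (x : L) (u : ExteriorAlgebra A L) :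
    D.toLinearMap (ι A x * u) = D.divergence x • u - ι A x * D.toLinearMap u -
      gerstenhaberBracket R A L (ι A x) u := by
  induction u using DirectSum.Decomposition.inductionOn fun i => ⋀[A]^i L with
  | zero => simp
  | add u v hu hv => simp only [mul_add, map_add, hu, hv, smul_add]; abel
  | homogeneous u =>
    rw [D.generates 1 _ _ _ (ι_mem x) u.2, D.map_ι, Algebra.smul_def]
    simp only [pow_one, neg_smul, one_smul]
    abel

theorem Generator.map_smul (D : Generator R A L) (a : A) (u : ExteriorAlgebra A L) :
    D.toLinearMap (a • u) = a • D.toLinearMap u +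
      gerstenhaberBracket R A L (algebraMap A _ a) u := by
  induction u using DirectSum.Decomposition.inductionOn fun i => ⋀[A]^i L with
  | zero => simp
  | add u v hu hv => simp only [smul_add, map_add, hu, hv]; abel
  | homogeneous u =>
    rw [D.generates 0 _ _ _ (algebraMap_mem a) u.2, D.map_algebraMap]
    rw [pow_zero, one_smul, one_smul, zero_mul, sub_zero, ← Algebra.smul_def, ← Algebra.smul_def,
      add_sub_cancel]

theorem Generator.divergence_smul (D : Generator R A L) (a : A) (x : L) :
    D.divergence (a • x) = a * D.divergence x - ⁅x, a⁆ := by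
  have h := D.map_smul a (ι A x)
  rw [← _root_.map_smul, D.map_ι, D.map_ι, bracket_algebraMap_ι, Algebra.smul_def, ← map_mul,
    ← map_neg, ← map_add, algebraMap_inj] at h
  rw [h, sub_eq_add_neg]

theorem Generator.divergence_add (D : Generator R A L) (x y : L) :
    D.divergence (x + y) = D.divergence x + D.divergence y := by
  simp only [Generator.divergence, map_add]

theorem Generator.ext_divergence {D D' : Generator R A L}
    (h : ∀ x, D.divergence x = D'.divergence x) : D = D' := by
  apply Generator.ext
  ext u
  induction u using extAlg_induction with
  | alg r => exact (D.map_algebraMap r).trans (D'.map_algebraMap r).symm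
  | add u v hu hv => rw [map_add, map_add, hu, hv]
  | ι_mul z u hu =>
    refine (D.map_ι_mul z u).trans (Eq.trans ?_ (D'.map_ι_mul z u).symm)
    rw [h, hu]

/-- The exterior algebra as a module over itself, with the action twisted by the grade
involution. -/
def InvoluteModule (A L : Type*) [CommRing A] [AddCommGroup L] [Module A L] : Type _ :=
  ExteriorAlgebra A L

instance (A L : Type*) [CommRing A] [AddCommGroup L] [Module A L] :
    AddCommGroup (InvoluteModule A L) :=
  inferInstanceAs (AddCommGroup (ExteriorAlgebra A L))

instance (A L : Type*) [CommRing A] [AddCommGroup L] [Module A L] :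
    Module (ExteriorAlgebra A L) (InvoluteModule A L) :=
  Module.compHom (ExteriorAlgebra A L)
    (CliffordAlgebra.involute (Q := (0 : QuadraticForm A L))).toRingHom

/-- The recursion `T (x ∧ u) = -x ∧ T u + g x u` is solved by `exists_twisted`; the minus sign is
absorbed by letting `x` act on the target through the grade involution. The operator is not
`A`-linear, its defect being `c a = [a, -]`. The rule for `δ (a • x)` makes the recursion compatible
with scalars, and `[x, x] = 0` makes it compatible with `x ∧ x = 0`. -/
theorem exists_operator_of_divergence (δ : L → A) (δ_add : ∀ x y, δ (x + y) = δ x + δ y)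
    (δ_smul : ∀ (a : A) x, δ (a • x) = a * δ x - ⁅x, a⁆) :
    ∃ T : ExteriorAlgebra A L →ₗ[R] ExteriorAlgebra A L, (∀ a, T (algebraMap A _ a) = 0) ∧
      (∀ x u, T (ι A x * u) = δ x • u - ι A x * T u - gerstenhaberBracket R A L (ι A x) u) ∧
      ∀ (a : A) u, T (a • u) = a • T u + gerstenhaberBracket R A L (algebraMap A _ a) u := by
  have s1 : ∀ (y : L) (w : ExteriorAlgebra A L),
      (ι A y • (show InvoluteModule A L from w) : InvoluteModule A L) = (-(ι A y * w) :) :=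
    fun y w => by
      change CliffordAlgebra.involute (ι A y) * w = _
      rw [CliffordAlgebra.involute_ι, neg_mul]
  have s2 : ∀ (a : A) (w : ExteriorAlgebra A L),
      (algebraMap A (ExteriorAlgebra A L) a • (show InvoluteModule A L from w) :
        InvoluteModule A L) = (a • w :) :=
    fun a w => by
      change CliffordAlgebra.involute (algebraMap A (ExteriorAlgebra A L) a) * w = _
      rw [AlgHom.commutes, Algebra.smul_def]
  let c : A → ExteriorAlgebra A L → ExteriorAlgebra A L := fun a u =>
    gerstenhaberBracket R A L (algebraMap A _ a) u
  let g : L → ExteriorAlgebra A L → ExteriorAlgebra A L := fun y u =>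
    δ y • u - gerstenhaberBracket R A L (ι A y) u
  obtain ⟨T, t1, t2, t3⟩ := exists_twisted (A := A) (L := L) (P := InvoluteModule A L) c g
    (fun a u v => map_add _ _ _)
    (fun a b u => by
      change c (a + b) u = c a u + c b u
      simp only [c, map_add, LinearMap.add_apply])
    (fun a b u => by
      refine Eq.trans ?_ (congrArg (· + c a (b • u)) (s2 a (c b u)).symm)
      change c (a * b) u = a • c b u + c a (b • u)
      simp only [c, bracket_algebraMap_mul, bracket_algebraMap_smul])
    (fun y u v => by
      change g y (u + v) = g y u + g y v
      simp only [g, map_add, smul_add]; abel)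
    (fun y z u => by
      change g (y + z) u = g y u + g z u
      simp only [g, map_add, δ_add, add_smul, LinearMap.add_apply]; abel)
    (fun a y u => by
      refine Eq.trans ?_ (congrArg (· + c a (ι A y * u)) (s2 a (g y u)).symm)
      change g (a • y) u = a • g y u + c a (ι A y * u)
      simp only [g, c, bracket_ι_smul_left, bracket_algebraMap_ι_mul, δ_smul, sub_smul, smul_sub,
        mul_smul]
      abel)
    (fun a y u => by
      refine Eq.trans (congrArg (· + g y (a • u)) (s1 y (c a u)))
        (Eq.trans ?_ (congrArg (· + c a (ι A y * u)) (s2 a (g y u)).symm))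
      change -(ι A y * c a u) + g y (a • u) = a • g y u + c a (ι A y * u)
      simp only [g, c, bracket_algebraMap_ι_mul, bracket_ι_smul, smul_sub, smul_comm a]
      abel)
    (fun y u => by
      refine Eq.trans (congrArg (· + g y (ι A y * u)) (s1 y (g y u))) ?_
      change -(ι A y * g y u) + g y (ι A y * u) = 0
      simp only [g, bracket_ι_ι_mul, lie_self, map_zero, zero_mul, zero_add, mul_sub,
        mul_smul_comm]
      abel)
  -- The same operator, with values read in the exterior algebra under its ordinary action.
  let T' : ExteriorAlgebra A L → ExteriorAlgebra A L := T
  have t3' : ∀ (a : A) u, T' (a • u) = a • T' u +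
      gerstenhaberBracket R A L (algebraMap A _ a) u := fun a u =>
    (t3 a u).trans (congrArg (· + c a u) (s2 a (T u)))
  refine ⟨{ toFun := T', map_add' := T.map_add, map_smul' := fun r u => ?_ }, ?_, ?_, t3'⟩
  · rw [← algebraMap_smul A r u, t3', bracket_algebraMap_algebraMap, add_zero, algebraMap_smul,
      RingHom.id_apply]
  · intro a
    refine (t1 a).trans ?_
    change gerstenhaberBracket R A L (algebraMap A _ a) 1 = 0
    rw [← map_one (algebraMap A (ExteriorAlgebra A L))]
    exact isGerstenhaberBracket_gerstenhaberBracket.lie_algebraMap_algebraMap a 1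
  · intro x u
    refine (t2 x u).trans ((congrArg (· + g x u) (s1 x (T u))).trans ?_)
    change -(ι A x * T' u) + (δ x • u - gerstenhaberBracket R A L (ι A x) u) =
      δ x • u - ι A x * T' u - gerstenhaberBracket R A L (ι A x) u
    abel

theorem exists_generator_of_divergence (δ : L → A) (δ_add : ∀ x y, δ (x + y) = δ x + δ y)
    (δ_smul : ∀ (a : A) x, δ (a • x) = a * δ x - ⁅x, a⁆) :
    ∃ D : Generator R A L, ∀ x, D.divergence x = δ x := by
  obtain ⟨T, t1, t2, t3⟩ := exists_operator_of_divergence (R := R) δ δ_add δ_smul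
  have t0 : ∀ u ∈ ⋀[A]^0 L, T u = 0 := fun u hu => by
    obtain ⟨a, rfl⟩ := mem_zero_iff.1 hu
    exact t1 a
  have hB := isGerstenhaberBracket_gerstenhaberBracket (R := R) (A := A) (L := L)
  refine ⟨⟨T, ?_, t0, ?_⟩, fun x => ?_⟩
  · intro p u hu
    refine extPow_induction (P := fun p u => ∀ q, p = q + 1 → T u ∈ ⋀[A]^q L)
      ?_ ?_ ?_ hu p rfl
    · intro a q hq; omega
    · intro p u v hu hv q hq
      rw [map_add]; exact add_mem (hu q hq) (hv q hq)
    · intro p y u hu h q hq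
      obtain rfl : p = q := by omega
      rw [t2]
      refine sub_mem (sub_mem (Submodule.smul_mem _ _ hu) ?_)
        (hB.lie_mem 1 p p (add_comm _ _) _ _ (ι_mem y) hu)
      -- For `p = 0` there is no degree for `T u` to lie in; it vanishes instead.
      rcases p with _ | p
      · rw [t0 u hu, mul_zero]; exact zero_mem _
      · exact ι_mul_mem y (h p rfl)
  · intro p q u v hu hv
    have e : ∀ p : ℕ, (-1 : ℤ) ^ p * (-1) ^ p = 1 := fun p => by rw [← mul_pow]; simp
    -- The generating identity solved for `T (u v)`, in which form it passes from `u` to `y ∧ u` by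
    -- the recursion and the derivation rules of the bracket in each argument.
    have key : T (u * v) = T u * v + (-1 : ℤ) ^ p • (u * T v) +
        (-1 : ℤ) ^ p • gerstenhaberBracket R A L u v := by
      refine extPow_induction (P := fun p u => T (u * v) = T u * v + (-1 : ℤ) ^ p • (u * T v) +
        (-1 : ℤ) ^ p • gerstenhaberBracket R A L u v) ?_ ?_ ?_ hu
      · intro a
        rw [← Algebra.smul_def, t3, t1, zero_mul, zero_add, pow_zero, one_smul, one_smul,
          Algebra.smul_def]
      · intro p u w hu hw
        simp only [add_mul, map_add, hu, hw, smul_add, LinearMap.add_apply]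
        abel
      · intro p y u hu h
        rw [mul_assoc, t2, h, t2, bracket_ι_mul y hu, bracket_ι_mul_left y hu hv]
        simp only [pow_succ, mul_neg_one, neg_smul, smul_add, smul_smul, neg_mul, e, mul_add, sub_mul,
          mul_smul_comm, smul_mul_assoc, mul_assoc, one_smul]
        abel
    have : T (u * v) - T u * v - (-1 : ℤ) ^ p • (u * T v) =
        (-1 : ℤ) ^ p • gerstenhaberBracket R A L u v := by
      rw [key]; abel
    rw [this, smul_smul, e, one_smul]
  · change ExteriorAlgebra.algebraMapInv (T (ι A x)) = δ x
    have h := t2 x (algebraMap A _ 1)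
    rw [t1, mul_zero, sub_zero, bracket_ι_algebraMap, lie_one, map_zero, sub_zero, map_one,
      mul_one, ← Algebra.algebraMap_eq_smul_one] at h
    rw [h, ExteriorAlgebra.algebraMap_leftInverse]

end Generator

/-! ### Alternating sums over omitted factors, and the bracket sum of a wedge. -/

section BracketSum

variable {A L : Type*} [CommRing A] [AddCommGroup L] [Module A L]

theorem ιMulti_cons {k : ℕ} (x : L) (ξ : Fin k → L) :
    ιMulti A (k + 1) (Fin.cons (α := fun _ => L) x ξ) = ι A x * ιMulti A k ξ := by
  rw [ιMulti_succ_apply]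
  rfl

theorem removeNth_succ_cons {α : Type*} {k : ℕ} (i : Fin (k + 1)) (x : α) (ξ : Fin (k + 1) → α) :
    i.succ.removeNth (Fin.cons (α := fun _ => α) x ξ) =
      Fin.cons (α := fun _ => α) x (i.removeNth ξ) := by
  ext j
  refine Fin.cases ?_ (fun j => ?_) j
  · simp [Fin.removeNth]
  · simp [Fin.removeNth]

theorem sum_neg_one_pow_mul {ι : Type*} (s : Finset ι) (c : ι → ℤ) (x : ExteriorAlgebra A L)
    (F : ι → ExteriorAlgebra A L) : ∑ i ∈ s, c i • (x * F i) = x * ∑ i ∈ s, c i • F i := by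
  simp only [Finset.mul_sum, mul_smul_comm]

theorem ιMulti_mem {k : ℕ} (ξ : Fin k → L) : ιMulti A k ξ ∈ ⋀[A]^k L :=
  ExteriorAlgebra.ιMulti_range A k ⟨ξ, rfl⟩

/-- Moving `ξ i` back to its place costs exactly the sign `(-1) ^ i`, so all `k + 1` terms are
equal. -/
theorem sum_neg_one_pow_ι_mul_removeNth {k : ℕ} (ξ : Fin (k + 1) → L) :
    ∑ i : Fin (k + 1), (-1 : ℤ) ^ (i : ℕ) • (ι A (ξ i) * ιMulti A k (i.removeNth ξ)) =
      ((k : ℤ) + 1) • ιMulti A (k + 1) ξ := by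
  induction k with
  | zero =>
    refine Fin.consCases (fun x ξ => ?_) ξ
    simp
  | succ k ih =>
    refine Fin.consCases (fun x ξ => ?_) ξ
    have sw : ∀ y : L, ι A y * ι A x = -(ι A x * ι A y) := fun y =>
      eq_neg_of_add_eq_zero_left (ExteriorAlgebra.ι_add_mul_swap y x)
    rw [Fin.sum_univ_succ]
    simp only [removeNth_succ_cons, Fin.cons_succ, Fin.cons_zero, ιMulti_cons, Fin.val_succ,
      pow_succ, ← mul_assoc (ι A _) (ι A x), sw, mul_neg_one, neg_smul, neg_mul, smul_neg, neg_neg]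
    simp only [mul_assoc]
    rw [sum_neg_one_pow_mul, ih]
    simp only [mul_smul_comm, Fin.val_zero, pow_zero, one_smul, Fin.removeNth_zero, Fin.tail_cons]
    push_cast
    simp only [add_smul, one_smul]
    abel

end BracketSum

section BracketSum

variable {A L : Type*} [CommRing A] [LieRing L] [Module A L]

/-- Since `φ_α` is left multiplication by `α` after the wedge, only the bracket sum of the wedge
itself has to be studied. -/
theorem coe_bracketSum_wedgeAdjoint {p k n : ℕ} (h : p + k = n) (α : ⋀[A]^p L)
    (ξ : Fin (k + 1) → L) :
    ((bracketSum (wedgeAdjoint h α) ξ : ⋀[A]^n L) : ExteriorAlgebra A L) =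
      α * bracketSum (ιMulti A k) ξ := by
  cases k with
  | zero => simp [bracketSum]
  | succ k =>
    rw [bracketSum, bracketSum]
    simp only [AddSubmonoidClass.coe_finsetSum, Finset.mul_sum, mul_smul_comm]
    refine Finset.sum_congr rfl fun i _ => Finset.sum_congr rfl fun j _ => ?_
    rw [← coe_wedgeAdjoint_apply h]
    rfl

theorem bracketSum_ιMulti_mem {k : ℕ} (ξ : Fin (k + 1) → L) :
    bracketSum (ιMulti A k) ξ ∈ ⋀[A]^k L := by
  cases k with
  | zero => exact zero_mem _
  | succ k =>
    exact sum_mem fun i _ => sum_mem fun j _ => zsmul_mem (ιMulti_mem _) _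

end BracketSum

/-! ### Expansion of a generator on wedge products. -/

section Cartan

variable {R A L : Type*} [CommRing R] [CommRing A] [Algebra R A] [LieRing L] [LieAlgebra R L]
  [Module A L] [LieRingModule L A] [LieRinehartRing A L] [LieRinehartAlgebra R A L]

/-- This is the Leibniz expansion of the Lie derivative, with each factor `[x, ξ i]` moved to the
front. -/
theorem sum_neg_one_pow_lie_ι {k : ℕ} (x : L) (ξ : Fin (k + 1) → L) :
    ∑ i : Fin (k + 1), (-1 : ℤ) ^ (i : ℕ) • (ι A ⁅x, ξ i⁆ * ιMulti A k (i.removeNth ξ)) =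
      gerstenhaberBracket R A L (ι A x) (ιMulti A (k + 1) ξ) := by
  induction k with
  | zero =>
    refine Fin.consCases (fun y ξ => ?_) ξ
    have h1 := bracket_ι_algebraMap (R := R) x (1 : A)
    rw [lie_one, map_zero, map_one] at h1
    simp [isGerstenhaberBracket_gerstenhaberBracket.lie_ι_ι]
  | succ k ih =>
    refine Fin.consCases (fun y ξ => ?_) ξ
    have sw : ∀ z : L, ι A z * ι A y = -(ι A y * ι A z) := fun z =>
      eq_neg_of_add_eq_zero_left (ExteriorAlgebra.ι_add_mul_swap z y)
    rw [Fin.sum_univ_succ]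
    simp only [removeNth_succ_cons, Fin.cons_succ, Fin.cons_zero, ιMulti_cons, Fin.val_succ,
      pow_succ, ← mul_assoc (ι A _) (ι A y), sw, mul_neg_one, neg_smul, neg_mul, smul_neg, neg_neg]
    simp only [mul_assoc]
    rw [sum_neg_one_pow_mul, ih, bracket_ι_ι_mul, Fin.val_zero, pow_zero, one_smul,
      Fin.removeNth_zero, Fin.tail_cons]

/-- Pairs involving the new first entry `x` add up to the Lie derivative. In the others, the index
shift by two costs no sign, and moving `x` to the front past the bracket costs one. -/
theorem bracketSum_succ {k : ℕ} (x : L) (ξ : Fin (k + 1) → L) :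
    bracketSum (ιMulti A (k + 1)) (Fin.cons (α := fun _ => L) x ξ) =
      -gerstenhaberBracket R A L (ι A x) (ιMulti A (k + 1) ξ) -
        ι A x * bracketSum (ιMulti A k) ξ := by
  have hIci : ∀ {m : ℕ} (i : Fin m) (F : Fin m → ExteriorAlgebra A L),
      ∑ j ∈ Finset.Ici i, F j = ∑ j, if i ≤ j then F j else 0 := fun i F => by
    rw [← Finset.sum_filter]; congr 1; ext j; simp
  rw [← sum_neg_one_pow_lie_ι, sub_eq_add_neg, bracketSum, Fin.sum_univ_succ]
  congr 1
  · rw [hIci, ← Finset.sum_neg_distrib]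
    refine Finset.sum_congr rfl fun j _ => ?_
    rw [ιMulti_cons]
    simp [-ιMulti_succ_apply, pow_succ]
  · cases k with
    | zero => simp [bracketSum]
    | succ k =>
      have sw : ∀ z : L, ι A z * ι A x = -(ι A x * ι A z) := fun z =>
        eq_neg_of_add_eq_zero_left (ExteriorAlgebra.ι_add_mul_swap z x)
      rw [bracketSum, Finset.mul_sum, ← Finset.sum_neg_distrib]
      refine Finset.sum_congr rfl fun i _ => ?_
      rw [hIci, hIci, Fin.sum_univ_succ, if_neg (by simp), zero_add, Finset.mul_sum,
        ← Finset.sum_neg_distrib]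
      refine Finset.sum_congr rfl fun j _ => ?_
      rw [← Fin.succ_castSucc, removeNth_succ_cons, removeNth_succ_cons]
      simp only [Fin.succ_le_succ_iff, Fin.cons_succ, Fin.val_succ, mul_ite, mul_zero]
      split_ifs
      · rw [ιMulti_cons, ιMulti_cons, ιMulti_cons, ← mul_assoc, sw, mul_smul_comm, ← mul_assoc,
          neg_mul, smul_neg, show (i : ℕ) + 1 + (j + 1 + 1) = (i + (j + 1)) + 2 by ring, pow_add]
        simp
      · simp

/-- Expansion of a generator on `ξ_0 ∧ ⋯ ∧ ξ_k ∧ u` as a second order operator. -/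
theorem Generator.sum_ι_mul_map (D : Generator R A L) {k : ℕ} (ξ : Fin (k + 1) → L)
    (u : ExteriorAlgebra A L) :
    ∑ i : Fin (k + 1), (-1 : ℤ) ^ (i : ℕ) •
        (ι A (ξ i) * D.toLinearMap (ιMulti A k (i.removeNth ξ) * u)) =
      -((k : ℤ) • D.toLinearMap (ιMulti A (k + 1) ξ * u)) +
        (-1 : ℤ) ^ k • (ιMulti A (k + 1) ξ * D.toLinearMap u) +
        bracketSum (ιMulti A k) ξ * u := by
  induction k with
  | zero =>
    refine Fin.consCases (fun x ξ => ?_) ξ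
    simp [bracketSum]
  | succ k ih =>
    refine Fin.consCases (fun x ξ => ?_) ξ
    -- The derivation rule turns `ξ_i ∧ [x, w]` into `[x, ξ_i ∧ w] - [x, ξ_i] ∧ w`, and both
    -- resulting sums are known.
    have hl : ∑ i : Fin (k + 1), (-1 : ℤ) ^ (i : ℕ) • (ι A (ξ i) *
        gerstenhaberBracket R A L (ι A x) (ιMulti A k (i.removeNth ξ) * u)) =
        ((k : ℤ) + 1) • gerstenhaberBracket R A L (ι A x) (ιMulti A (k + 1) ξ * u) -
          gerstenhaberBracket R A L (ι A x) (ιMulti A (k + 1) ξ) * u := by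
      rw [← map_zsmul, ← smul_mul_assoc, ← sum_neg_one_pow_ι_mul_removeNth,
        ← sum_neg_one_pow_lie_ι x ξ, Finset.sum_mul, Finset.sum_mul, map_sum,
        ← Finset.sum_sub_distrib]
      refine Finset.sum_congr rfl fun i _ => ?_
      rw [smul_mul_assoc, smul_mul_assoc, mul_assoc, mul_assoc, map_zsmul, bracket_ι_ι_mul,
        smul_add, add_sub_cancel_left]
    -- Expand `D (x ∧ w)` by the recursion, then bring `x` in front of `ξ i` so that the induction
    -- hypothesis applies.
    have hc : ∀ i : Fin (k + 1), (-1 : ℤ) ^ ((i.succ : Fin (k + 2)) : ℕ) • (ι A (ξ i) *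
        D.toLinearMap (ι A x * ιMulti A k (i.removeNth ξ) * u)) =
        -(D.divergence x • ((-1 : ℤ) ^ (i : ℕ) • (ι A (ξ i) * ιMulti A k (i.removeNth ξ)) * u)) -
        ι A x * ((-1 : ℤ) ^ (i : ℕ) •
          (ι A (ξ i) * D.toLinearMap (ιMulti A k (i.removeNth ξ) * u))) +
        (-1 : ℤ) ^ (i : ℕ) • (ι A (ξ i) *
          gerstenhaberBracket R A L (ι A x) (ιMulti A k (i.removeNth ξ) * u)) := fun i => by
      have sw : ι A (ξ i) * ι A x = -(ι A x * ι A (ξ i)) :=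
        eq_neg_of_add_eq_zero_left (ExteriorAlgebra.ι_add_mul_swap _ x)
      rw [mul_assoc (ι A x), D.map_ι_mul, Fin.val_succ, pow_succ, mul_neg_one, neg_smul, mul_sub,
        mul_sub, ← mul_assoc _ (ι A x), sw, mul_smul_comm, smul_sub, smul_sub, neg_mul, smul_neg,
        smul_comm _ (D.divergence x), mul_assoc, mul_smul_comm, smul_mul_assoc, mul_assoc]
      abel
    rw [Fin.sum_univ_succ]
    simp only [removeNth_succ_cons, Fin.cons_succ, Fin.cons_zero, ιMulti_cons, hc]
    rw [Finset.sum_add_distrib, Finset.sum_sub_distrib, Finset.sum_neg_distrib, ← Finset.smul_sum,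
      ← Finset.mul_sum, ← Finset.sum_mul, ih, hl, sum_neg_one_pow_ι_mul_removeNth,
      bracketSum_succ (R := R), mul_assoc (ι A x) _ u, D.map_ι_mul]
    have hp : ∀ v : ExteriorAlgebra A L, (-1 : ℤ) ^ (k + 1) • v = -((-1 : ℤ) ^ k • v) := fun v => by
      rw [pow_succ, mul_neg_one, neg_smul]
    simp only [Fin.val_zero, pow_zero, one_smul, Fin.removeNth_zero, Fin.tail_cons, mul_add,
      mul_neg, mul_smul_comm, smul_mul_assoc, sub_mul, neg_mul, mul_assoc, hp, smul_sub,
      smul_comm (D.divergence x) (k : ℤ), smul_add, Nat.cast_add, Nat.cast_one, add_smul, add_mul]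
    abel

end Cartan

/-! ### The correspondence between generators and connections in top degree. -/

section Correspondence

variable {R A L : Type*} [CommRing R] [CommRing A] [Algebra R A] [LieRing L] [LieAlgebra R L]
  [Module A L] [LieRingModule L A] [LieRinehartRing A L] [LieRinehartAlgebra R A L] {n : ℕ}

theorem ι_mul_eq_zero {A L : Type*} [CommRing A] [AddCommGroup L] [Module A L] {n : ℕ}
    (htop : ∀ u ∈ ⋀[A]^(n + 1) L, u = 0) (x : L) {ω : ExteriorAlgebra A L}
    (hω : ω ∈ ⋀[A]^n L) : ι A x * ω = 0 :=
  htop _ (ι_mul_mem x hω)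

theorem coe_lieDerivative (x : L) (ω : ⋀[A]^n L) :
    (lieDerivative R A n x ω : ExteriorAlgebra A L) = gerstenhaberBracket R A L (ι A x) ω := rfl

/-- In top degree, the correspondence by Lie derivatives reads `∇_x ω = -x ∧ D ω`. -/
theorem lieCorresponds_iff (htop : ∀ u ∈ ⋀[A]^(n + 1) L, u = 0) {D : Generator R A L}
    {nabla : Connection R A L (⋀[A]^n L)} : LieCorresponds n D nabla ↔
      ∀ (x : L) (ω : ⋀[A]^n L), (nabla.toLinearMap x ω : ExteriorAlgebra A L) =
        -(ι A x * D.toLinearMap ω) := by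
  refine forall₂_congr fun x ω => ?_
  -- As `x ∧ ω = 0`, the recursion reads `0 = (D x) ω - x ∧ D ω - λ_x ω`.
  have h := D.map_ι_mul x ω
  rw [ι_mul_eq_zero htop x ω.2, map_zero, eq_comm, sub_eq_zero, sub_eq_iff_eq_add] at h
  rw [D.map_ι, ← Algebra.smul_def, h, AddSubgroupClass.coe_sub, coe_lieDerivative, sub_eq_add_neg,
    add_right_inj, eq_comm, neg_eq_iff_eq_neg]

/-- Substitute `∇_x ω = -x ∧ D ω` and move `α` to the right. In the expansion
`Generator.sum_ι_mul_map` the first term contains a wedge of degree `n + 1`, which is zero, and the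
bracket sum cancels the one in the definition of the covariant derivative. -/
theorem coe_covariantDerivative_wedgeAdjoint (htop : ∀ u ∈ ⋀[A]^(n + 1) L, u = 0)
    {D : Generator R A L} {nabla : Connection R A L (⋀[A]^n L)} (h : LieCorresponds n D nabla)
    {p k : ℕ} (hpk : p + k = n) (α : ⋀[A]^p L) (ξ : Fin (k + 1) → L) :
    ((nabla.covariantDerivative p (wedgeAdjoint hpk α) ξ : ⋀[A]^n L) : ExteriorAlgebra A L) =
      (-1 : ℤ) ^ (p + p * k + k) • (ιMulti A (k + 1) ξ * D.toLinearMap α) := by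
  rw [lieCorresponds_iff htop] at h
  have h1 : ∀ i : Fin (k + 1),
      (((-1 : ℤ) ^ (i : ℕ) • nabla.toLinearMap (ξ i) (wedgeAdjoint hpk α (i.removeNth ξ)) :
        ⋀[A]^n L) : ExteriorAlgebra A L) = -((-1 : ℤ) ^ (p * k) • ((-1 : ℤ) ^ (i : ℕ) •
        (ι A (ξ i) * D.toLinearMap (ιMulti A k (i.removeNth ξ) * α)))) := fun i => by
    change (-1 : ℤ) ^ (i : ℕ) • ((nabla.toLinearMap (ξ i) (wedgeAdjoint hpk α (i.removeNth ξ)) :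
        ⋀[A]^n L) : ExteriorAlgebra A L) = _
    rw [h, coe_wedgeAdjoint_apply, graded_comm α.2 (ιMulti_mem _), map_zsmul, mul_smul_comm,
      smul_neg, smul_comm]
  change (-1 : ℤ) ^ (p + 1) • ((∑ i : Fin (k + 1), (-1 : ℤ) ^ (i : ℕ) • nabla.toLinearMap (ξ i)
    (wedgeAdjoint hpk α (i.removeNth ξ)) + bracketSum (wedgeAdjoint hpk α) ξ : ⋀[A]^n L) :
      ExteriorAlgebra A L) = _
  rw [AddMemClass.coe_add, AddSubmonoidClass.coe_finsetSum, coe_bracketSum_wedgeAdjoint,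
    Finset.sum_congr rfl fun i _ => h1 i, Finset.sum_neg_distrib, ← Finset.smul_sum,
    D.sum_ι_mul_map, htop (ιMulti A (k + 1) ξ * α) (by
      have := SetLike.mul_mem_graded (A := fun i : ℕ => ⋀[A]^i L) (ιMulti_mem (A := A) ξ) α.2
      rwa [show k + 1 + p = n + 1 by omega] at this),
    graded_comm α.2 (bracketSum_ιMulti_mem ξ), map_zero, smul_zero, neg_zero, zero_add,
    smul_add ((-1 : ℤ) ^ (p * k)), neg_add, neg_add_cancel_right, smul_neg, smul_smul, smul_smul,
    pow_succ, mul_neg_one, neg_mul, neg_mul, neg_smul, neg_neg, ← pow_add, ← pow_add]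

theorem LieCorresponds.corresponds (htop : ∀ u ∈ ⋀[A]^(n + 1) L, u = 0)
    {D : Generator R A L} {nabla : Connection R A L (⋀[A]^n L)} (h : LieCorresponds n D nabla) :
    Corresponds n D nabla where
  degree_zero α ξ := by
    apply Subtype.ext
    change (0 : ExteriorAlgebra A L) =
      -((nabla.covariantDerivative 0 (wedgeAdjoint (zero_add n) α) ξ : ⋀[A]^n L) : _)
    rw [coe_covariantDerivative_wedgeAdjoint htop h, D.map_zero_degree _ α.2, mul_zero, smul_zero,
      neg_zero]
  degree_succ p k hp hp' α ξ := by
    apply Subtype.ext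
    change _ = -((nabla.covariantDerivative (p + 1) (wedgeAdjoint hp α) ξ : ⋀[A]^n L) :
      ExteriorAlgebra A L)
    rw [coe_covariantDerivative_wedgeAdjoint htop h, coe_wedgeAdjoint_apply,
      graded_comm (D.component p α).2 (ιMulti_mem ξ),
      -- The sign `p * (k + 1)` comes from moving `D α` past the `k + 1` arguments; the odd
      -- remainder is the minus sign of the relation.
      show p + 1 + (p + 1) * k + k = p * (k + 1) + 1 + 2 * k by ring, pow_add _ _ (2 * k), pow_succ,
      pow_mul _ 2]
    simp only [neg_one_sq, one_pow, mul_one, mul_neg_one, neg_smul, neg_neg]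
    rfl

/-- For `α = ω` of top degree the covariant derivative has a single argument and no bracket term, so
the relation is already `∇_x ω = -x ∧ D ω`. -/
theorem Corresponds.lieCorresponds (htop : ∀ u ∈ ⋀[A]^(n + 1) L, u = 0)
    {D : Generator R A L} {nabla : Connection R A L (⋀[A]^n L)} (h : Corresponds n D nabla) :
    LieCorresponds n D nabla := by
  rw [lieCorresponds_iff htop]
  intro x ω
  -- If `n = 0`, top degree is degree zero, and the relation has its separate form with zero on the
  -- left.
  cases n with
  | zero =>
    have e := congrArg Subtype.val (h.degree_zero ω fun _ => x)
    have e1 : wedgeAdjoint (zero_add 0) ω ![] = ω := by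
      apply Subtype.ext
      rw [coe_wedgeAdjoint_apply, ιMulti_zero_apply, mul_one]
    rw [D.map_zero_degree _ ω.2, mul_zero, neg_zero]
    have e2 : nabla.covariantDerivative 0 (wedgeAdjoint (zero_add 0) ω) (fun _ => x) =
        -nabla.toLinearMap x ω := by
      rw [Connection.covariantDerivative, bracketSum, add_zero, Fin.sum_univ_one]
      simp only [Fin.val_zero, pow_zero, one_smul, zero_add, pow_one, neg_smul]
      rw [Subsingleton.elim (Fin.removeNth 0 fun _ => x) ![], e1]
    rw [e2, neg_neg] at e
    exact e.symm
  | succ m =>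
    have e := congrArg Subtype.val (h.degree_succ m 0 rfl rfl ω fun _ => x)
    have e1 : wedgeAdjoint (add_zero (m + 1)) ω ![] = ω := by
      apply Subtype.ext
      rw [coe_wedgeAdjoint_apply, ιMulti_zero_apply, mul_one]
    have e2 : nabla.covariantDerivative (m + 1) (wedgeAdjoint (add_zero (m + 1)) ω) (fun _ => x) =
        (-1 : ℤ) ^ m • nabla.toLinearMap x ω := by
      rw [Connection.covariantDerivative, bracketSum, add_zero, Fin.sum_univ_one]
      simp only [Fin.val_zero, pow_zero, one_smul, pow_succ, mul_neg_one, neg_neg]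
      rw [Subsingleton.elim (Fin.removeNth 0 fun _ => x) ![], e1]
    rw [e2, coe_wedgeAdjoint_apply, graded_comm (D.component m ω).2 (ιMulti_mem _)] at e
    change _ = -((-1 : ℤ) ^ m • (nabla.toLinearMap x ω : ExteriorAlgebra A L)) at e
    rw [ιMulti_succ_apply, ιMulti_zero_apply, mul_one, zero_add, mul_one, ← smul_neg] at e
    have e3 := congrArg (fun w => (-1 : ℤ) ^ m • w) e
    simp only [smul_smul, ← mul_pow, neg_mul_neg, mul_one, one_pow, one_smul] at e3
    exact neg_eq_iff_eq_neg.1 e3.symm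

theorem corresponds_iff_lieCorresponds (htop : ∀ u ∈ ⋀[A]^(n + 1) L, u = 0)
    {D : Generator R A L} {nabla : Connection R A L (⋀[A]^n L)} :
    Corresponds n D nabla ↔ LieCorresponds n D nabla :=
  ⟨fun h => h.lieCorresponds htop, fun h => h.corresponds htop⟩

theorem lieDerivative_smul (x : L) (a : A) (ω : ⋀[A]^n L) :
    lieDerivative R A n x (a • ω) = ⁅x, a⁆ • ω + a • lieDerivative R A n x ω :=
  Subtype.ext (bracket_ι_smul x a (ω : ExteriorAlgebra A L))

theorem lieDerivative_add_left (x y : L) (ω : ⋀[A]^n L) :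
    lieDerivative R A n (x + y) ω = lieDerivative R A n x ω + lieDerivative R A n y ω := by
  apply Subtype.ext
  change gerstenhaberBracket R A L (ι A (x + y)) ω = gerstenhaberBracket R A L (ι A x) ω +
    gerstenhaberBracket R A L (ι A y) ω
  rw [map_add, map_add, LinearMap.add_apply]

/-- Bracketing `x ∧ ω = 0` with `a` gives `x ∧ [a, ω] = -x(a) ω`, which evaluates the correction in
`bracket_ι_smul_left`. The divergence has the same defect, so the difference is `A`-linear in `x`.
-/
theorem lieDerivative_smul_left (htop : ∀ u ∈ ⋀[A]^(n + 1) L, u = 0) (a : A) (x : L)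
    (ω : ⋀[A]^n L) :
    lieDerivative R A n (a • x) ω = a • lieDerivative R A n x ω - ⁅x, a⁆ • ω := by
  apply Subtype.ext
  change gerstenhaberBracket R A L (ι A (a • x)) ω =
    a • gerstenhaberBracket R A L (ι A x) ω - ⁅x, a⁆ • (ω : ExteriorAlgebra A L)
  have h := bracket_algebraMap_ι_mul (R := R) a x (ω : ExteriorAlgebra A L)
  rw [ι_mul_eq_zero htop x ω.2, map_zero, eq_comm, sub_eq_zero] at h
  rw [bracket_ι_smul_left, ← h, sub_eq_add_neg]

theorem lieCorresponds_iff_eq {D : Generator R A L} {nabla : Connection R A L (⋀[A]^n L)} :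
    LieCorresponds n D nabla ↔ ∀ (x : L) (ω : ⋀[A]^n L),
      nabla.toLinearMap x ω = lieDerivative R A n x ω - D.divergence x • ω := by
  refine forall₂_congr fun x ω => ?_
  rw [D.map_ι, ← Algebra.smul_def, ← SetLike.val_smul, Subtype.coe_inj, eq_sub_iff_add_eq,
    add_comm, eq_sub_iff_add_eq]

/-- The connection `∇_x ω = λ_x ω - (D x) ω` defined by a generator `D`. -/
def Generator.toConnection (htop : ∀ u ∈ ⋀[A]^(n + 1) L, u = 0) (D : Generator R A L) :
    Connection R A L (⋀[A]^n L) where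
  toLinearMap :=
    { toFun := fun x => lieDerivative R A n x -
        (LinearMap.lsmul A (⋀[A]^n L) (D.divergence x)).restrictScalars R
      map_add' := fun x y => by
        ext1 ω
        change lieDerivative R A n (x + y) ω - D.divergence (x + y) • ω =
          (lieDerivative R A n x ω - D.divergence x • ω) +
            (lieDerivative R A n y ω - D.divergence y • ω)
        rw [lieDerivative_add_left, D.divergence_add, add_smul]
        abel
      map_smul' := fun a x => by
        ext1 ω
        change lieDerivative R A n (a • x) ω - D.divergence (a • x) • ω =
          a • (lieDerivative R A n x ω - D.divergence x • ω)
        rw [lieDerivative_smul_left htop, D.divergence_smul, sub_smul _ _ ω, mul_smul, smul_sub]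
        abel }
  leibniz x a ω := by
    change lieDerivative R A n x (a • ω) - D.divergence x • a • ω =
      a • (lieDerivative R A n x ω - D.divergence x • ω) + ⁅x, a⁆ • ω
    rw [lieDerivative_smul, smul_sub, smul_comm a]
    abel

theorem Generator.toConnection_apply (htop : ∀ u ∈ ⋀[A]^(n + 1) L, u = 0) (D : Generator R A L)
    (x : L) (ω : ⋀[A]^n L) : (D.toConnection htop).toLinearMap x ω =
      lieDerivative R A n x ω - D.divergence x • ω := rfl

theorem toConnection_eq_iff (htop : ∀ u ∈ ⋀[A]^(n + 1) L, u = 0) (D : Generator R A L)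
    (nabla : Connection R A L (⋀[A]^n L)) :
    D.toConnection htop = nabla ↔ LieCorresponds n D nabla := by
  rw [lieCorresponds_iff_eq]
  refine ⟨fun h x ω => by rw [← h]; rfl, fun h => ?_⟩
  apply Connection.ext
  ext x ω : 2
  exact (h x ω).symm

/-- Every endomorphism of the top exterior power is a scalar. -/
theorem existsUnique_smul_of_bijective {A L : Type*} [CommRing A] [AddCommGroup L] [Module A L]
    {n : ℕ} (hbij : Function.Bijective (wedgeAdjoint (A := A) (L := L) (zero_add n)))
    (F : ⋀[A]^n L →ₗ[A] ⋀[A]^n L) : ∃! a : A, ∀ ω, F ω = a • ω := by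
  -- Endomorphisms of `Λ^n L` are alternating `n`-forms with values in `Λ^n L`, and scalars are the
  -- elements of degree zero: the claim is the case `p = 0` of the isomorphism.
  have key : ∀ a : A, (∀ ω, F ω = a • ω) ↔ wedgeAdjoint (zero_add n)
      ⟨algebraMap A (ExteriorAlgebra A L) a, algebraMap_mem a⟩ =
        F.compAlternatingMap (exteriorPower.ιMulti A n) := by
    intro a
    have h1 : wedgeAdjoint (zero_add n)
        ⟨algebraMap A (ExteriorAlgebra A L) a, algebraMap_mem a⟩ =
        (a • LinearMap.id : ⋀[A]^n L →ₗ[A] ⋀[A]^n L).compAlternatingMap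
          (exteriorPower.ιMulti A n) := by
      ext ξ : 1
      apply Subtype.ext
      rw [coe_wedgeAdjoint_apply, ← Algebra.smul_def]
      rfl
    rw [h1]
    exact ⟨fun h => by ext ξ : 1; exact (h _).symm,
      fun h ω => (LinearMap.congr_fun (exteriorPower.linearMap_ext h) ω).symm⟩
  obtain ⟨α, hα⟩ := hbij.2 (F.compAlternatingMap (exteriorPower.ιMulti A n))
  obtain ⟨a, ha⟩ := mem_zero_iff.1 α.2
  refine ⟨a, (key a).2 ?_, fun b hb => ?_⟩
  · rw [← hα]; congr 1; exact Subtype.ext ha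
  · have := hbij.1 (((key b).1 hb).trans hα.symm)
    exact ExteriorAlgebra.algebraMap_leftInverse L |>.injective
      ((congrArg Subtype.val this).trans ha.symm)

theorem eq_of_forall_smul_eq {A L : Type*} [CommRing A] [AddCommGroup L] [Module A L] {n : ℕ}
    (hbij : Function.Bijective (wedgeAdjoint (A := A) (L := L) (zero_add n))) {a b : A}
    (h : ∀ ω : ⋀[A]^n L, a • ω = b • ω) : a = b :=
  (existsUnique_smul_of_bijective hbij (a • LinearMap.id)).unique (fun _ => rfl) h

theorem toConnection_bijective (htop : ∀ u ∈ ⋀[A]^(n + 1) L, u = 0)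
    (hbij : Function.Bijective (wedgeAdjoint (A := A) (L := L) (zero_add n))) :
    Function.Bijective (Generator.toConnection (R := R) (A := A) (L := L) htop) := by
  constructor
  · intro D D' h
    refine Generator.ext_divergence fun x => eq_of_forall_smul_eq hbij fun ω => ?_
    have := congrArg (fun c : Connection R A L (⋀[A]^n L) => c.toLinearMap x ω) h
    exact sub_right_inj.1 this
  · intro nabla
    -- The terms `x(a) ω` in the two Leibniz rules cancel, so the difference is `A`-linear and hence
    -- a scalar, the divergence sought.
    let F : L → ⋀[A]^n L →ₗ[A] ⋀[A]^n L := fun x =>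
      { toFun := fun ω => lieDerivative R A n x ω - nabla.toLinearMap x ω
        map_add' := fun ω ω' => by rw [map_add, map_add]; abel
        map_smul' := fun a ω => by
          rw [lieDerivative_smul, nabla.leibniz, RingHom.id_apply, smul_sub]; abel }
    choose δ hδ _ using fun x => existsUnique_smul_of_bijective hbij (F x)
    have hδ' : ∀ x ω, δ x • ω = lieDerivative R A n x ω - nabla.toLinearMap x ω :=
      fun x ω => (hδ x ω).symm
    obtain ⟨D, hD⟩ := exists_generator_of_divergence (R := R) δ
      (fun x y => eq_of_forall_smul_eq hbij fun ω => by
        rw [add_smul, hδ', hδ', hδ', lieDerivative_add_left, map_add, LinearMap.add_apply]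
        abel)
      (fun a x => eq_of_forall_smul_eq hbij fun ω => by
        rw [sub_smul _ _ ω, mul_smul, hδ', hδ', lieDerivative_smul_left htop, map_smul,
          LinearMap.smul_apply, smul_sub]
        abel)
    refine ⟨D, (toConnection_eq_iff htop D nabla).2 (lieCorresponds_iff_eq.2 fun x ω => ?_)⟩
    rw [hD, hδ', sub_sub_cancel]

end Correspondence

/-! ### Exactness and flatness. -/

section Curvature

variable {R A L : Type*} [CommRing R] [CommRing A] [Algebra R A] [LieRing L] [LieAlgebra R L]
  [Module A L] [LieRingModule L A] [LieRinehartRing A L] [LieRinehartAlgebra R A L] {n : ℕ}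

/-- The function `K` such that the curvature of the connection of a generator is the multiplication
by `K`. -/
def Generator.curvature (D : Generator R A L) (x y : L) : A :=
  ⁅y, D.divergence x⁆ - ⁅x, D.divergence y⁆ + D.divergence ⁅x, y⁆

/-- The Lie derivative is a representation of `L` and contributes nothing; what remains are the
derivatives of the divergences and the divergence of the bracket. -/
theorem Generator.curvature_toConnection (htop : ∀ u ∈ ⋀[A]^(n + 1) L, u = 0)
    (D : Generator R A L) (x y : L) (ω : ⋀[A]^n L) :
    (D.toConnection htop).toLinearMap x ((D.toConnection htop).toLinearMap y ω) -
      (D.toConnection htop).toLinearMap y ((D.toConnection htop).toLinearMap x ω) -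
      (D.toConnection htop).toLinearMap ⁅x, y⁆ ω = D.curvature x y • ω := by
  have h : lieDerivative R A n ⁅x, y⁆ ω = lieDerivative R A n x (lieDerivative R A n y ω) -
      lieDerivative R A n y (lieDerivative R A n x ω) :=
    Subtype.ext (lie_bracket_ι x y (ω : ExteriorAlgebra A L))
  simp only [D.toConnection_apply, h, map_sub, lieDerivative_smul, Generator.curvature, add_smul,
    sub_smul, smul_sub, smul_comm (D.divergence y) (D.divergence x)]
  abel

theorem Generator.isFlat_toConnection_iff (htop : ∀ u ∈ ⋀[A]^(n + 1) L, u = 0)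
    (hbij : Function.Bijective (wedgeAdjoint (A := A) (L := L) (zero_add n)))
    (D : Generator R A L) :
    (D.toConnection htop).IsFlat ↔ ∀ x y, D.curvature x y = 0 := by
  refine forall₂_congr fun x y => ⟨fun h => eq_of_forall_smul_eq hbij fun ω => ?_, fun h ω => ?_⟩
  · rw [← D.curvature_toConnection htop, h, sub_self, zero_smul]
  · have := D.curvature_toConnection htop x y ω
    rw [h, zero_smul, sub_eq_zero] at this
    exact this.symm

theorem Generator.map_map_ι_mul_ι (D : Generator R A L) (x y : L) :
    D.toLinearMap (D.toLinearMap (ι A x * ι A y)) = -algebraMap A _ (D.curvature x y) := by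
  have h : D.toLinearMap (ι A x * ι A y) =
      ι A (D.divergence x • y - D.divergence y • x - ⁅x, y⁆) := by
    rw [D.map_ι_mul, D.map_ι, isGerstenhaberBracket_gerstenhaberBracket.lie_ι_ι,
      ← Algebra.commutes, ← Algebra.smul_def, map_sub, map_sub, _root_.map_smul, _root_.map_smul]
  have hs : ∀ u v : L, D.divergence (u - v) = D.divergence u - D.divergence v := fun u v => by
    simp only [Generator.divergence, map_sub]
  rw [h, D.map_ι, ← map_neg, hs, hs, D.divergence_smul, D.divergence_smul, Generator.curvature,
    mul_comm (D.divergence y)]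
  congr 1
  ring

/-- Isolates the obstruction to `D²` commuting with left multiplication by `x`: the commutator of
`λ_x` with `D`, corrected by the bracket with `D x`. -/
theorem Generator.map_map_ι_mul (D : Generator R A L) (x : L) (u : ExteriorAlgebra A L) :
    D.toLinearMap (D.toLinearMap (ι A x * u)) = ι A x * D.toLinearMap (D.toLinearMap u) +
      (gerstenhaberBracket R A L (ι A x) (D.toLinearMap u) -
        D.toLinearMap (gerstenhaberBracket R A L (ι A x) u) +
        gerstenhaberBracket R A L (algebraMap A _ (D.divergence x)) u) := by
  rw [D.map_ι_mul, map_sub, map_sub, D.map_smul, D.map_ι_mul]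
  abel

/-- Writing `E u` for the left-hand side, one finds `E (y ∧ u) = -K(x, y) u - y ∧ E u`, so `E`
vanishes by induction when `K` does. -/
theorem Generator.commutator_lieDerivative (D : Generator R A L)
    (h : ∀ x y, D.curvature x y = 0) (x : L) (u : ExteriorAlgebra A L) :
    gerstenhaberBracket R A L (ι A x) (D.toLinearMap u) -
      D.toLinearMap (gerstenhaberBracket R A L (ι A x) u) +
      gerstenhaberBracket R A L (algebraMap A _ (D.divergence x)) u = 0 := by
  induction u using extAlg_induction with
  | alg a =>
    rw [D.map_algebraMap, bracket_ι_algebraMap, D.map_algebraMap,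
      isGerstenhaberBracket_gerstenhaberBracket.lie_algebraMap_algebraMap]
    simp
  | add u v hu hv =>
    rw [← add_zero (0 : ExteriorAlgebra A L)]
    nth_rw 1 [← hu]
    rw [← hv]
    simp only [map_add]
    abel
  | ι_mul y u hu =>
    have e : gerstenhaberBracket R A L (ι A x) (D.toLinearMap (ι A y * u)) -
        D.toLinearMap (gerstenhaberBracket R A L (ι A x) (ι A y * u)) +
        gerstenhaberBracket R A L (algebraMap A _ (D.divergence x)) (ι A y * u) =
        -(D.curvature x y • u) - ι A y * (gerstenhaberBracket R A L (ι A x) (D.toLinearMap u) -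
          D.toLinearMap (gerstenhaberBracket R A L (ι A x) u) +
          gerstenhaberBracket R A L (algebraMap A _ (D.divergence x)) u) := by
      simp only [bracket_ι_ι_mul, D.map_ι_mul, map_add, map_sub, bracket_ι_smul, lie_bracket_ι,
        bracket_algebraMap_ι_mul, Generator.curvature, mul_add, mul_sub, add_smul, sub_smul]
      abel
    rw [e, hu, h, zero_smul, mul_zero, neg_zero, sub_zero]

/-- Products of two elements of `L` detect `K`; conversely, if `K = 0` then `D²` passes through left
multiplication by `L` and it kills `A`. -/
theorem Generator.isExact_iff (D : Generator R A L) :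
    D.IsExact ↔ ∀ x y, D.curvature x y = 0 := by
  constructor
  · intro h x y
    have := D.map_map_ι_mul_ι x y
    rw [h, eq_comm, neg_eq_zero, algebraMap_eq_zero_iff] at this
    exact this
  · intro h u
    induction u using extAlg_induction with
    | alg a => rw [D.map_algebraMap, map_zero]
    | add u v hu hv => rw [map_add, map_add, hu, hv, add_zero]
    | ι_mul x u hu => rw [D.map_map_ι_mul, hu, mul_zero, D.commutator_lieDerivative h, add_zero]

end Curvature

end LieRinehart

end


/-! ### Generators and connections for a projective module of constant rank. -/

theorem theorem1p8 (R A L : Type*) [CommRing R] [CommRing A] [Algebra R A] [LieRing L]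
    [LieAlgebra R L] [Module A L] [LieRingModule L A] [LieRinehartRing A L]
    [LieRinehartAlgebra R A L] [Module.Finite A L] [Module.Projective A L] (n : ℕ)
    (hn : ∀ P : PrimeSpectrum A, Module.rankAtStalk L P = n) :
    (∀ (p k : ℕ) (h : p + k = n),
      Function.Bijective (LieRinehart.wedgeAdjoint (A := A) (L := L) h)) ∧
    ∃ e : LieRinehart.Generator R A L ≃ LieRinehart.Connection R A L (⋀[A]^n L),
      (∀ D nabla, e D = nabla ↔ LieRinehart.Corresponds n D nabla) ∧
      (∀ D, D.IsExact ↔ (e D).IsFlat) ∧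
      (∀ D nabla, e D = nabla ↔ LieRinehart.LieCorresponds n D nabla) := by
  have hbij : ∀ (p k : ℕ) (h : p + k = n),
      Function.Bijective (LieRinehart.wedgeAdjoint (A := A) (L := L) h) := fun p k h =>
    ⟨LieRinehart.wedgeAdjoint_injective hn h, LieRinehart.wedgeAdjoint_surjective hn h⟩
  have htop : ∀ u ∈ ⋀[A]^(n + 1) L, u = 0 := fun u hu =>
    LieRinehart.eq_zero_of_mem_extPow hn n.lt_succ_self hu
  have h0 := hbij 0 n (zero_add n)
  refine ⟨hbij, Equiv.ofBijective _ (LieRinehart.toConnection_bijective htop h0),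
    fun D nabla => ?_, fun D => ?_, LieRinehart.toConnection_eq_iff htop⟩
  · rw [LieRinehart.corresponds_iff_lieCorresponds htop]
    exact LieRinehart.toConnection_eq_iff htop D nabla
  · rw [D.isExact_iff]
    exact (D.isFlat_toConnection_iff htop h0).symm
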